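/- **Theorem (FLLN for the non-Markovian Lebensztayn–Machado–Rodríguez model).** Let $\lambda,\theta,\gamma:\mathbb R_+\to\mathbb R_+$ be bounded measurable functions, $\delta\in[0,1]$, $\theta_1,\theta_2>0$ and $\beta=\theta_1/(\theta_1+\theta_2)$. *Stochastic intensity.* A counting process $N$ ($N(0)=0$, nondecreasing, right-continuous, finite, jumps of size one) adapted to a filtration $\mathcal F=(\mathcal F_t)_{t\ge0}$ has $\mathcal F$-intensity $\ell$ if $\ell\ge0$ is $\mathcal F$-progressive, $\int_0^t\ell(s)\,ds<\infty$ a.s. for all $t$, and $\mathbb E\int_0^\infty C(s)\,dN(s)=\mathbb E\int_0^\infty C(s)\ell(s)\,ds$ for every nonnegative $\mathcal F$-predictable process $C$. *Model.* For every $n\ge1$, on a common probability space, let $X^n,U^n,Y^n,Z^n$ be $\mathbb N_0$-valued processes (numbers of ignorant, uninterested, spreader and stifler individuals) with $X^n(t)+U^n(t)+Y^n(t)+Z^n(t)=n$ for all $t\ge0$. Let $(\mathcal U_i)_{i\ge1}$ be independent uniform random variables on $[0,1]$, and likewise $(\mathcal W_i)_{i\ge1}$ (both families may depend on $n$). Let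 $A^n,B^n,C^n$ be counting processes and $\mathcal F^n$ a filtration to which $X^n,U^n,Y^n,Z^n,A^n,B^n,C^n$ are adapted, such that $A^n,B^n,C^n$ have the $\mathcal F^n$-intensities $$\lambda(t)X^n(t)\frac{Y^n(t)}n,\qquad \theta(t)\,(Y^n(t)-1)\frac{Y^n(t)}n,\qquad \gamma(t)\,(U^n(t)+Z^n(t))\frac{Y^n(t)}n,$$ respectively, and such that for all $t\ge0$ $$\begin{aligned} U^n(t)&=U^n(0)+\sum_{i=1}^{A^n(t)}\mathbf 1(\mathcal U_i\ge\delta),\\ Y^n(t)&=Y^n(0)+\sum_{i=1}^{A^n(t)}\mathbf 1(\mathcal U_i<\delta)-B^n(t)-\sum_{i=1}^{B^n(t)}\mathbf 1(\mathcal W_i\ge\beta)-C^n(t),\\ Z^n(t)&=Z^n(0)+B^n(t)+\sum_{i=1}^{B^n(t)}\mathbf 1(\mathcal W_i\ge\beta)+C^n(t). \end{aligned}$$ Write $\bar V^n=V^n/n$ for each of these processes. *Initial condition (Condition III).* Assume that $(\bar U^n(0),\bar Y^n(0),\bar Z^n(0))\to(\bar U(0),\bar Y(0),\bar Z(0))$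 in probability as $n\to\infty$, where $\bar U(0),\bar Y(0),\bar Z(0)$ are strictly positive constants with $\bar U(0)+\bar Y(0)+\bar Z(0)<1$. *Conclusion.* The system, for all $t\ge0$, $$\begin{aligned} \bar X(t)&=1-\bar U(t)-\bar Y(t)-\bar Z(t),\\ \bar U(t)&=\bar U(0)+\int_0^t\lambda(s)(1-\delta)\bar X(s)\bar Y(s)\,ds,\\ \bar Y(t)&=\bar Y(0)+\int_0^t\lambda(s)\,\delta\,\bar X(s)\bar Y(s)\,ds-\int_0^t\theta(s)(2-\beta)\bar Y(s)^2\,ds-\int_0^t\gamma(s)(\bar U(s)+\bar Z(s))\bar Y(s)\,ds,\\ \bar Z(t)&=\bar Z(0)+\int_0^t\theta(s)(2-\beta)\bar Y(s)^2\,ds+\int_0^t\gamma(s)(\bar U(s)+\bar Z(s))\bar Y(s)\,ds \end{aligned}$$ has exactly one càdlàg solution $(\bar X,\bar U,\bar Y,\bar Z)$ on $[0,\infty)$, and $(\bar X^n,\bar U^n,\bar Y^n,\bar Z^n)\to(\bar X,\bar U,\bar Y,\bar Z)$ in probability in $D^4$, that is, for all $T\ge0$ and $\varepsilon>0$, $$\lim_{n\to\infty}\mathbb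 P\Big(\sup_{0\le t\le T}\big\|(\bar X^n,\bar U^n,\bar Y^n,\bar Z^n)(t)-(\bar X,\bar U,\bar Y,\bar Z)(t)\big\|>\varepsilon\Big)=0 .$$ -/

import Mathlib

open MeasureTheory ProbabilityTheory Filter Topology Set
open scoped NNReal ENNReal

noncomputable section

/-- Lebesgue measure on the time half-line `[0, ∞)`. -/
def leb : Measure ℝ≥0 := Measure.comap ((↑) : ℝ≥0 → ℝ) volume

theorem leb_Icc (a b : ℝ≥0) : leb (Icc a b) = ENNReal.ofReal ((b : ℝ) - a) := by
  have hs : MeasurableSet (Ici (0 : ℝ)) := measurableSet_Ici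
  have he : MeasurableEmbedding ((↑) : ℝ≥0 → ℝ) := MeasurableEmbedding.subtype_coe hs
  have himg : ((↑) : ℝ≥0 → ℝ) '' (Icc a b) = Icc (a : ℝ) b := by
    ext x
    constructor
    · rintro ⟨y, hy, rfl⟩
      exact ⟨NNReal.coe_le_coe.2 hy.1, NNReal.coe_le_coe.2 hy.2⟩
    · intro hx
      exact ⟨⟨x, a.2.trans hx.1⟩, ⟨hx.1, hx.2⟩, rfl⟩
  rw [leb, he.comap_apply, himg, Real.volume_Icc]

/-! ### Counting processes and stochastic intensity -/

/-- A (simple, non-explosive) counting process: every path starts at `0`, is nondecreasing and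
right-continuous, and increases by jumps of size one. -/
structure IsCountingProcess {Ω : Type*} (N : ℝ≥0 → Ω → ℕ) : Prop where
  zero : ∀ ω, N 0 ω = 0
  mono : ∀ ω, Monotone fun t => N t ω
  rightCts : ∀ ω t, ContinuousWithinAt (fun s => N s ω) (Ici t) t
  unitJumps : ∀ ω t, 0 < t → ∃ s < t, N t ω ≤ N s ω + 1

/-- The epoch at which the counting process makes its `(i + 1)`-st jump (`i = 0, 1, …`); meaningful
when the path does reach the value `i + 1`. -/
def epoch {Ω : Type*} (N : ℝ≥0 → Ω → ℕ) (i : ℕ) (ω : Ω) : ℝ≥0 :=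
  sInf {t | i + 1 ≤ N t ω}

open Classical in
/-- The pathwise integral `∫₀^∞ C(s) dN(s)` of a nonnegative process against a counting process:
the sum of the values of `C` at the (finite) epochs of `N`. -/
def countingIntegral {Ω : Type*} (C : ℝ≥0 → Ω → ℝ≥0) (N : ℝ≥0 → Ω → ℕ) (ω : Ω) : ℝ≥0∞ :=
  ∑' i : ℕ, if ∃ t, i + 1 ≤ N t ω then (C (epoch N i ω) ω : ℝ≥0∞) else 0

/-- The counting process `N` admits the `𝓕`-stochastic intensity `ℓ`. -/
structure HasStochasticIntensity {Ω : Type*} [mΩ : MeasurableSpace Ω] (P : Measure Ω)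
    (𝓕 : Filtration ℝ≥0 mΩ) (N : ℝ≥0 → Ω → ℕ) (ℓ : ℝ≥0 → Ω → ℝ) : Prop where
  counting : IsCountingProcess N
  adapted : Adapted 𝓕 N
  nonneg : ∀ t ω, 0 ≤ ℓ t ω
  progressive : IsProgressive 𝓕 ℓ
  finite : ∀ t : ℝ≥0, ∀ᵐ ω ∂P, ∫⁻ s in Icc 0 t, ENNReal.ofReal (ℓ s ω) ∂leb < ∞
  intensity : ∀ C : ℝ≥0 → Ω → ℝ≥0, IsStronglyPredictable 𝓕 C →
    ∫⁻ ω, countingIntegral C N ω ∂P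
      = ∫⁻ ω, ∫⁻ s, (C s ω : ℝ≥0∞) * ENNReal.ofReal (ℓ s ω) ∂leb ∂P

/-! ### The rumor model -/

/-- A family of independent random variables, each uniform on `[0, 1]`. -/
def IsIIDUniform {Ω : Type*} [MeasurableSpace Ω] (P : Measure Ω) (ξ : ℕ → Ω → ℝ) : Prop :=
  iIndepFun ξ P ∧ ∀ i, pdf.IsUniform (ξ i) (Icc (0 : ℝ) 1) P volume

/-- The data of a rumor process on `Ω`: numbers of ignorants `X`, uninterested `U`, spreaders `Y`
and stiflers `Z`; the counting processes `A` (spreader-ignorant), `B` (spreader-spreader) and `C`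
(spreader-stifler) of interactions; the marks attached to the epochs of `A` and of `B`
(`markA i`, `markB i` belong to the `(i + 1)`-st epoch); the history `𝓕`. -/
structure RumorProcess (Ω : Type*) [mΩ : MeasurableSpace Ω] where
  X : ℝ≥0 → Ω → ℕ
  U : ℝ≥0 → Ω → ℕ
  Y : ℝ≥0 → Ω → ℕ
  Z : ℝ≥0 → Ω → ℕ
  A : ℝ≥0 → Ω → ℕ
  B : ℝ≥0 → Ω → ℕ
  C : ℝ≥0 → Ω → ℕ
  markA : ℕ → Ω → ℝ
  markB : ℕ → Ω → ℝ
  𝓕 : Filtration ℝ≥0 mΩ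

open Classical in
/-- The number of indices `i < k` whose mark lies in `S`. -/
def markCount {Ω : Type*} (ξ : ℕ → Ω → ℝ) (S : Set ℝ) (k : ℕ) (ω : Ω) : ℕ :=
  ((Finset.range k).filter fun i => ξ i ω ∈ S).card

/-- `R` is a non-Markovian Lebensztayn–Machado–Rodríguez model with `n` individuals and parameter
functions `lam`, `th`, `gam`. At an epoch of `A` an ignorant becomes a spreader if the mark is
`< δ`, and uninterested otherwise. At an epoch of `B` one spreader becomes a stifler, and a second
one does if the mark is `≥ β`. At an epoch of `C` one spreader becomes a stifler.
The history is any filtration to which the class sizes are adapted and relative to which `A`, `B`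
and `C` have the prescribed intensities (which includes that they are adapted). -/
structure IsLMRModel {Ω : Type*} [mΩ : MeasurableSpace Ω] (P : Measure Ω) (n : ℕ)
    (lam th gam : ℝ≥0 → ℝ≥0) (δ β : ℝ) (R : RumorProcess Ω) : Prop where
  adapted_X : Adapted R.𝓕 R.X
  adapted_U : Adapted R.𝓕 R.U
  adapted_Y : Adapted R.𝓕 R.Y
  adapted_Z : Adapted R.𝓕 R.Z
  uniform_markA : IsIIDUniform P R.markA
  uniform_markB : IsIIDUniform P R.markB
  intensity_A : HasStochasticIntensity P R.𝓕 R.A fun t ω =>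
    (lam t : ℝ) * (R.X t ω : ℝ) * ((R.Y t ω : ℝ) / n)
  intensity_B : HasStochasticIntensity P R.𝓕 R.B fun t ω =>
    (th t : ℝ) * ((R.Y t ω : ℝ) - 1) * ((R.Y t ω : ℝ) / n)
  intensity_C : HasStochasticIntensity P R.𝓕 R.C fun t ω =>
    (gam t : ℝ) * ((R.U t ω : ℝ) + (R.Z t ω : ℝ)) * ((R.Y t ω : ℝ) / n)
  closed : ∀ t ω, R.X t ω + R.U t ω + R.Y t ω + R.Z t ω = n
  eq_U : ∀ t ω, R.U t ω = R.U 0 ω + markCount R.markA (Ici δ) (R.A t ω) ω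
  eq_Y : ∀ t ω, (R.Y t ω : ℤ) = (R.Y 0 ω : ℤ) + (markCount R.markA (Iio δ) (R.A t ω) ω : ℤ)
    - (R.B t ω : ℤ) - (markCount R.markB (Ici β) (R.B t ω) ω : ℤ) - (R.C t ω : ℤ)
  eq_Z : ∀ t ω, R.Z t ω = R.Z 0 ω + R.B t ω + markCount R.markB (Ici β) (R.B t ω) ω + R.C t ω

/-! ### The space `D` and the limiting system -/

/-- Right-continuous with left limits on `[0, ∞)`. -/
def IsCadlag {E : Type*} [TopologicalSpace E] (f : ℝ≥0 → E) : Prop :=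
  ∀ t, ContinuousWithinAt f (Ici t) t ∧ ∃ l, Tendsto f (𝓝[<] t) (𝓝 l)

/-- Convergence in probability of processes `V n` to a deterministic `v` in `D([0,∞), ℝᵏ)`,
uniformly on every compact time interval: for all `T` and `ε > 0`, the probability that
`sup_{t ≤ T} ‖V n t - v t‖ > ε` tends to `0`. -/
def ConvergesInProbabilityD {Ω : Type*} [MeasurableSpace Ω] (P : Measure Ω) {k : ℕ}
    (V : ℕ → ℝ≥0 → Ω → Fin k → ℝ) (v : ℝ≥0 → Fin k → ℝ) : Prop :=
  ∀ T : ℝ≥0, ∀ ε : ℝ, 0 < ε →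
    Tendsto (fun n => P {ω | ∃ t ≤ T, ε < ‖V n t ω - v t‖}) atTop (𝓝 0)

/-- `(x, u, y, z)` is a càdlàg solution of the limiting deterministic integral system with initial
proportions `u₀`, `y₀`, `z₀`. -/
structure IsFluidSolution (lam th gam : ℝ≥0 → ℝ≥0) (δ β u₀ y₀ z₀ : ℝ)
    (x u y z : ℝ≥0 → ℝ) : Prop where
  cadlag_x : IsCadlag x
  cadlag_u : IsCadlag u
  cadlag_y : IsCadlag y
  cadlag_z : IsCadlag z
  eq_x : ∀ t, x t = 1 - u t - y t - z t
  eq_u : ∀ t, u t = u₀ + ∫ s in Icc 0 t, (lam s : ℝ) * (1 - δ) * x s * y s ∂leb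
  eq_y : ∀ t, y t = y₀ + (∫ s in Icc 0 t, (lam s : ℝ) * δ * x s * y s ∂leb)
    - (∫ s in Icc 0 t, (th s : ℝ) * (2 - β) * y s ^ 2 ∂leb)
    - ∫ s in Icc 0 t, (gam s : ℝ) * (u s + z s) * y s ∂leb
  eq_z : ∀ t, z t = z₀ + (∫ s in Icc 0 t, (th s : ℝ) * (2 - β) * y s ^ 2 ∂leb)
    + ∫ s in Icc 0 t, (gam s : ℝ) * (u s + z s) * y s ∂leb

end

noncomputable section

/-! ### Integration on the time half-line -/

/-! The scaled model is a small perturbation of the fluid system, and the fluid system is stable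
under small perturbations. The conclusion is reached pathwise on an event of probability close to
one.

The random input has two sources. The first is the difference between each of `A`, `B`, `C` and its
integrated intensity. The counts are at most `n` and the intensities at most `K * n`, so the second
moment of this difference at a fixed time is `O(n)` (`HasStochasticIntensity.lintegral_sub_sq_le`).
No martingale theory is needed: the bound follows from the defining identity of the intensity,
applied to two predictable integrands. Chebyshev's inequality on a fixed finite grid and
monotonicity of the paths then give uniformity on `[0, T]` (`tendsto_measure_compensated`). The
second source is the marks. Hoeffding's inequality and a union bound control their partial sums
simultaneously for all `k ≤ n` (`tendsto_measure_markCount`). Since this is uniform in `k`, the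
random index `A t` or `B t` may be substituted for `k`, whatever the dependence between marks and
counting processes.

When these errors and those of the initial proportions are all small, the scaled paths solve the
fluid equations up to a small error (`IsLMRModel.isApproxFluid`). All paths are bounded, so the
quadratic drift is Lipschitz along them, and Grönwall's inequality bounds the distance between two
approximate solutions (`IsApproxFluid.abs_sub_le`). With zero error the same estimate gives
uniqueness.

Existence (`exists_fluidSolution`) is Picard's theorem for the cumulative interaction counts, with
every proportion in the rates truncated to `[0, 1]`. The resulting proportions remain in `[0, 1]`,
so the truncation is inactive and the original system is solved. -/

theorem measurableEmbedding_nnreal_coe : MeasurableEmbedding ((↑) : ℝ≥0 → ℝ) :=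
  MeasurableEmbedding.subtype_coe measurableSet_Ici

instance leb_nullSingleton : NullSingletonClass leb where
  measure_singleton a := by
    rw [← Icc_self, leb_Icc]
    simp

instance leb_locallyFinite : IsLocallyFiniteMeasure leb where
  finiteAtNhds t := by
    refine ⟨Icc 0 (t + 1), ?_, ?_⟩
    · rw [← bot_eq_zero, Icc_bot]
      exact Iic_mem_nhds (lt_add_of_pos_right t one_pos)
    · rw [leb_Icc]
      exact ENNReal.ofReal_lt_top

theorem leb_Ioc (a b : ℝ≥0) : leb (Ioc a b) = ENNReal.ofReal ((b : ℝ) - a) := by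
  rw [measure_congr Ioc_ae_eq_Icc, leb_Icc]

theorem leb_Icc_zero_ne_top (t : ℝ≥0) : leb (Icc 0 t) ≠ ∞ := by
  rw [leb_Icc]
  exact ENNReal.ofReal_ne_top

theorem leb_real_Icc_zero (t : ℝ≥0) : leb.real (Icc 0 t) = t := by
  rw [measureReal_def, leb_Icc]
  simp

/-- A measurable function bounded on `[0, t]` is integrable there. -/
theorem integrableOn_leb_of_bounded {f : ℝ≥0 → ℝ} (hf : Measurable f) {t : ℝ≥0} {K : ℝ}
    (hb : ∀ s ≤ t, |f s| ≤ K) : IntegrableOn f (Icc 0 t) leb := by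
  refine Measure.integrableOn_of_bounded (leb_Icc_zero_ne_top t) hf.aestronglyMeasurable
    (M := K) ?_
  filter_upwards [ae_restrict_mem measurableSet_Icc] with s hs
  exact hb s hs.2

theorem abs_integral_leb_le {f : ℝ≥0 → ℝ} {t : ℝ≥0} {K : ℝ} (hb : ∀ s ≤ t, |f s| ≤ K) :
    |∫ s in Icc 0 t, f s ∂leb| ≤ K * t := by
  have := norm_setIntegral_le_of_norm_le_const (μ := leb) (s := Icc 0 t) (f := f) (C := K)
    (leb_Icc_zero_ne_top t).lt_top (fun s hs => hb s hs.2)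
  rwa [leb_real_Icc_zero] at this

theorem integral_leb_add_Ioc {f : ℝ≥0 → ℝ} {s t : ℝ≥0} (hst : s ≤ t)
    (hf : IntegrableOn f (Icc 0 t) leb) :
    ∫ r in Icc 0 t, f r ∂leb = (∫ r in Icc 0 s, f r ∂leb) + ∫ r in Ioc s t, f r ∂leb := by
  have hu : Icc 0 t = Icc 0 s ∪ Ioc s t := (Icc_union_Ioc_eq_Icc zero_le hst).symm
  rw [hu] at hf ⊢
  refine setIntegral_union ?_ measurableSet_Ioc hf.left_of_union hf.right_of_union
  exact disjoint_left.2 fun x hx hx' => hx'.1.not_ge hx.2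

theorem abs_integral_Ioc_leb_le {f : ℝ≥0 → ℝ} {s t : ℝ≥0} (hst : s ≤ t) {K : ℝ}
    (hb : ∀ r ≤ t, |f r| ≤ K) : |∫ r in Ioc s t, f r ∂leb| ≤ K * ((t : ℝ) - s) := by
  have := norm_setIntegral_le_of_norm_le_const (μ := leb) (s := Ioc s t) (f := f) (C := K)
    (by rw [leb_Ioc]; exact ENNReal.ofReal_lt_top) (fun r hr => hb r hr.2)
  rwa [measureReal_def, leb_Ioc, ENNReal.toReal_ofReal (sub_nonneg.2 (NNReal.coe_le_coe.2 hst))]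
    at this

/-- Primitives of bounded measurable functions are continuous. -/
theorem continuous_integral_leb {f : ℝ≥0 → ℝ} (hf : Measurable f) {K : ℝ}
    (hb : ∀ s, |f s| ≤ K) : Continuous fun t => ∫ s in Icc 0 t, f s ∂leb := by
  have hK : 0 ≤ K := (abs_nonneg _).trans (hb 0)
  have key : ∀ s t : ℝ≥0, s ≤ t →
      |(∫ r in Icc 0 t, f r ∂leb) - ∫ r in Icc 0 s, f r ∂leb| ≤ K * |(t : ℝ) - s| := by
    intro s t hst
    rw [integral_leb_add_Ioc hst (integrableOn_leb_of_bounded hf fun r _ => hb r),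
      add_sub_cancel_left, abs_of_nonneg (sub_nonneg.2 (NNReal.coe_le_coe.2 hst))]
    exact abs_integral_Ioc_leb_le hst fun r _ => hb r
  refine (LipschitzWith.of_dist_le_mul (K := K.toNNReal) fun t s => ?_).continuous
  rw [Real.dist_eq, NNReal.dist_eq, Real.coe_toNNReal _ hK]
  rcases le_total s t with h | h
  · exact key s t h
  · rw [abs_sub_comm, abs_sub_comm (t : ℝ)]
    exact key t s h

theorem integral_exp_leb_le {c : ℝ} (hc : 0 < c) (t : ℝ≥0) :
    ∫ s in Icc 0 t, Real.exp (c * s) ∂leb ≤ Real.exp (c * t) / c := by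
  have hpre : ((↑) : ℝ≥0 → ℝ) ⁻¹' (Icc 0 (t : ℝ)) = Icc 0 t := by
    ext x
    simp [mem_Icc]
  have hsub : Icc 0 (t : ℝ) ⊆ range ((↑) : ℝ≥0 → ℝ) := fun x hx => ⟨⟨x, hx.1⟩, rfl⟩
  have h1 : ∫ s in Icc 0 t, Real.exp (c * s) ∂leb = ∫ r in Icc 0 (t : ℝ), Real.exp (c * r) := by
    rw [← hpre, ← measurableEmbedding_nnreal_coe.setIntegral_map (fun r => Real.exp (c * r)), leb,
      measurableEmbedding_nnreal_coe.map_comap, Measure.restrict_restrict measurableSet_Icc,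
      inter_eq_left.2 hsub]
  rw [h1, integral_Icc_eq_integral_Ioc, ← intervalIntegral.integral_of_le t.coe_nonneg,
    intervalIntegral.integral_comp_mul_left (fun x => Real.exp x) hc.ne', integral_exp]
  simp only [mul_zero, Real.exp_zero, smul_eq_mul]
  rw [inv_mul_eq_div]
  gcongr
  linarith

theorem integrableOn_exp_leb (c : ℝ) (t : ℝ≥0) :
    IntegrableOn (fun s : ℝ≥0 => Real.exp (c * s)) (Icc 0 t) leb :=
  (Continuous.continuousOn (by fun_prop)).integrableOn_compact isCompact_Icc

/-- Grönwall's inequality for bounded measurable functions. -/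
theorem gronwall_leb {d : ℝ≥0 → ℝ} {T : ℝ≥0} {a L M : ℝ} (hL : 0 < L)
    (hd : Measurable d) (h0 : ∀ t ≤ T, 0 ≤ d t) (hM : ∀ t ≤ T, d t ≤ M)
    (h : ∀ t ≤ T, d t ≤ a + L * ∫ s in Icc 0 t, d s ∂leb) (t : ℝ≥0) (ht : t ≤ T) :
    d t ≤ 2 * a * Real.exp (2 * L * t) := by
  set c := 2 * L with hc
  have hcpos : 0 < c := by positivity
  -- Under the weight `exp (-(c * s))` with `c = 2 * L`, the integral operator has norm at most `L /
  -- c = 1 / 2`. Hence `S ≤ a + S / 2`, that is `S ≤ 2 * a`.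
  let S : ℝ := sSup ((fun s : ℝ≥0 => Real.exp (-(c * s)) * d s) '' Icc 0 T)
  have hbdd : BddAbove ((fun s : ℝ≥0 => Real.exp (-(c * s)) * d s) '' Icc 0 T) := by
    refine ⟨M, ?_⟩
    rintro _ ⟨s, hs, rfl⟩
    calc Real.exp (-(c * s)) * d s ≤ 1 * d s := by
          refine mul_le_mul_of_nonneg_right ?_ (h0 s hs.2)
          rw [Real.exp_le_one_iff]
          have := s.2
          simp only [Left.neg_nonpos_iff]
          positivity
      _ ≤ M := by rw [one_mul]; exact hM s hs.2
  have hS : ∀ s ≤ T, d s ≤ S * Real.exp (c * s) := by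
    intro s hs
    have h1 : Real.exp (-(c * s)) * d s ≤ S := le_csSup hbdd ⟨s, ⟨zero_le, hs⟩, rfl⟩
    rw [Real.exp_neg, inv_mul_le_iff₀ (Real.exp_pos _)] at h1
    linarith
  have ha : ∀ s ≤ T, d s ≤ a + S / 2 * Real.exp (c * s) := by
    intro s hs
    have hS0 : 0 ≤ S := by
      have h1 := hS s hs
      have h2 := h0 s hs
      by_contra hneg
      have := mul_neg_of_neg_of_pos (not_le.1 hneg) (Real.exp_pos (c * s))
      linarith
    have h1 : ∫ r in Icc 0 s, d r ∂leb ≤ ∫ r in Icc 0 s, S * Real.exp (c * r) ∂leb := by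
      refine setIntegral_mono_on ?_ ((integrableOn_exp_leb c s).const_mul S) measurableSet_Icc
        fun r hr => hS r (hr.2.trans hs)
      refine integrableOn_leb_of_bounded hd (K := M) fun r hr => ?_
      rw [abs_of_nonneg (h0 r (hr.trans hs))]
      exact hM r (hr.trans hs)
    rw [integral_const_mul] at h1
    have h2 := mul_le_mul_of_nonneg_left (integral_exp_leb_le hcpos s) hS0
    have h3 := h s hs
    have h4 := mul_le_mul_of_nonneg_left (h1.trans h2) hL.le
    have h5 : L * (S * (Real.exp (c * s) / c)) = S / 2 * Real.exp (c * s) := by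
      rw [hc]
      field_simp
    linarith
  have ha0 : 0 ≤ a := by
    have h1 := h 0 zero_le
    have h2 := h0 0 zero_le
    simpa using h2.trans h1
  have hS2 : S ≤ a + S / 2 := by
    refine csSup_le ⟨_, mem_image_of_mem _ ⟨le_refl 0, zero_le⟩⟩ ?_
    rintro _ ⟨s, hs, rfl⟩
    have h1 := mul_le_mul_of_nonneg_left (ha s hs.2) (Real.exp_pos (-(c * s))).le
    have h2 : Real.exp (-(c * s)) * Real.exp (c * s) = 1 := by rw [← Real.exp_add]; simp
    have h3 : Real.exp (-(c * s)) ≤ 1 := by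
      rw [Real.exp_le_one_iff]
      have := s.2
      simp only [Left.neg_nonpos_iff]
      positivity
    have h4 := mul_le_mul_of_nonneg_right h3 ha0
    calc _ ≤ _ := h1
      _ = Real.exp (-(c * s)) * a + S / 2 * (Real.exp (-(c * s)) * Real.exp (c * s)) := by ring
      _ ≤ a + S / 2 := by rw [h2]; linarith
  refine (hS t ht).trans (mul_le_mul_of_nonneg_right (by linarith) (Real.exp_pos _).le)

/-! ### Picard's theorem for bounded, Lipschitz, measurable-in-time systems -/

open BoundedContinuousFunction in
-- Contraction on the whole half-line by an exponential weight: with `v t = exp (c * t) • g t`, `c =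
-- 2 * L` and `g` bounded continuous, the integral equation becomes a fixed-point problem for `Φ`,
-- whose Lipschitz constant is `L / c = 1 / 2`. No gluing of local solutions is required. Only
-- measurability in time is assumed of `F`, through its composition with continuous paths.
theorem exists_integral_solution {ι : Type*} [Fintype ι] (F : ℝ≥0 → (ι → ℝ) → ι → ℝ)
    (hmeas : ∀ v : ℝ≥0 → ι → ℝ, Continuous v → ∀ i, Measurable fun s => F s (v s) i)
    {K L : ℝ} (hL : 0 < L) (hb : ∀ s v i, |F s v i| ≤ K)
    (hlip : ∀ s v w i, |F s v i - F s w i| ≤ L * ‖v - w‖) :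
    ∃ v : ℝ≥0 → ι → ℝ, Continuous v ∧ ∀ t i, v t i = ∫ s in Icc 0 t, F s (v s) i ∂leb := by
  -- An index is needed to read `0 ≤ K` off `hb`.
  rcases isEmpty_or_nonempty ι with hι | ⟨⟨i₀⟩⟩
  · exact ⟨fun _ => 0, continuous_const, fun _ i => hι.elim i⟩
  set c := 2 * L with hc
  have hcpos : 0 < c := by positivity
  have hK : 0 ≤ K := (abs_nonneg _).trans (hb 0 0 i₀)
  have hcont : ∀ v : ℝ≥0 → ι → ℝ, Continuous v →
      Continuous fun (t : ℝ≥0) i => ∫ s in Icc 0 t, F s (v s) i ∂leb := fun v hv =>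
    continuous_pi fun i => continuous_integral_leb (hmeas v hv i) fun s => hb s (v s) i
  let E (g : ℝ≥0 →ᵇ (ι → ℝ)) (s : ℝ≥0) : ι → ℝ := Real.exp (c * s) • g s
  have hE : ∀ g, Continuous (E g) := fun g => by fun_prop
  let Φ (g : ℝ≥0 →ᵇ (ι → ℝ)) : ℝ≥0 →ᵇ (ι → ℝ) :=
    BoundedContinuousFunction.ofNormedAddCommGroup
      (fun (t : ℝ≥0) => Real.exp (-(c * t)) • fun i => ∫ s in Icc 0 t, F s (E g s) i ∂leb)
      ((by fun_prop : Continuous fun t : ℝ≥0 => Real.exp (-(c * t))).smul (hcont _ (hE g)))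
      (K / c) (by
        intro t
        rw [norm_smul, Real.norm_eq_abs, abs_of_pos (Real.exp_pos _), Real.exp_neg,
          inv_mul_le_iff₀ (Real.exp_pos _)]
        refine (pi_norm_le_iff_of_nonneg (by positivity)).2 fun i => ?_
        refine (abs_integral_leb_le fun s _ => hb s (E g s) i).trans ?_
        have h1 := Real.add_one_le_exp (c * t)
        rw [mul_div_assoc', le_div_iff₀ hcpos]
        nlinarith)
  have hΦval : ∀ (g : ℝ≥0 →ᵇ (ι → ℝ)) (t : ℝ≥0), Φ g t
      = Real.exp (-(c * t)) • fun i => ∫ s in Icc 0 t, F s (E g s) i ∂leb := fun _ _ => rfl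
  have hΦ : ContractingWith (1 / 2) Φ := by
    refine ⟨by rw [← NNReal.coe_lt_coe]; norm_num, LipschitzWith.of_dist_le_mul fun g h => ?_⟩
    refine (BoundedContinuousFunction.dist_le (by positivity)).2 fun t => ?_
    rw [hΦval, hΦval, dist_eq_norm, ← smul_sub, norm_smul, Real.norm_eq_abs,
      abs_of_pos (Real.exp_pos _), Real.exp_neg, inv_mul_le_iff₀ (Real.exp_pos _)]
    refine (pi_norm_le_iff_of_nonneg (by positivity)).2 fun i => ?_
    have hint : ∀ g, IntegrableOn (fun s => F s (E g s) i) (Icc 0 t) leb := fun g =>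
      integrableOn_leb_of_bounded (hmeas _ (hE g) i) fun s _ => hb s _ i
    rw [Pi.sub_apply, ← integral_sub (hint g) (hint h)]
    have h1 : ‖∫ s in Icc 0 t, (F s (E g s) i - F s (E h s) i) ∂leb‖
        ≤ ∫ s in Icc 0 t, L * dist g h * Real.exp (c * s) ∂leb := by
      refine norm_integral_le_of_norm_le ((integrableOn_exp_leb c t).const_mul _)
        (ae_of_all _ fun s => ?_)
      refine (hlip s _ _ i).trans ?_
      change L * ‖Real.exp (c * s) • g s - Real.exp (c * s) • h s‖ ≤ _
      rw [← smul_sub, norm_smul, Real.norm_eq_abs, abs_of_pos (Real.exp_pos _), ← dist_eq_norm,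
        mul_assoc L (dist g h), mul_comm (dist g h)]
      gcongr
      exact BoundedContinuousFunction.dist_coe_le_dist s
    refine h1.trans ?_
    rw [integral_const_mul]
    refine (mul_le_mul_of_nonneg_left (integral_exp_leb_le hcpos t) (by positivity)).trans ?_
    rw [hc]
    push_cast
    apply le_of_eq
    field_simp
  obtain ⟨g, hg, -⟩ := hΦ.exists_fixedPoint 0 (edist_ne_top _ _)
  refine ⟨E g, hE g, fun t i => ?_⟩
  have h1 : g t = Real.exp (-(c * t)) • fun i => ∫ s in Icc 0 t, F s (E g s) i ∂leb :=
    (congrArg (fun f : ℝ≥0 →ᵇ (ι → ℝ) => f t) hg.eq).symm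
  change (Real.exp (c * t) • g t) i = _
  rw [h1, smul_smul, ← Real.exp_add]
  simp

/-! ### Càdlàg functions -/

theorem Continuous.isCadlag {f : ℝ≥0 → ℝ} (hf : Continuous f) : IsCadlag f := fun t =>
  ⟨hf.continuousWithinAt, f t, hf.continuousWithinAt⟩

/-- The smallest multiple of `1 / (k + 1)` that is larger than `t`. -/
def rightApprox (k : ℕ) (t : ℝ≥0) : ℝ≥0 :=
  ((⌊((k : ℝ≥0) + 1) * t⌋₊ : ℝ≥0) + 1) / ((k : ℝ≥0) + 1)

theorem tendsto_rightApprox (t : ℝ≥0) : Tendsto (fun k => rightApprox k t) atTop (𝓝[≥] t) := by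
  have hle : ∀ k, t ≤ rightApprox k t := fun k => by
    rw [rightApprox, le_div_iff₀ (by positivity), mul_comm]
    exact (Nat.lt_floor_add_one _).le
  have hge : ∀ k : ℕ, rightApprox k t ≤ t + 1 / ((k : ℝ≥0) + 1) := fun k => by
    rw [rightApprox, div_le_iff₀ (by positivity), add_mul t, div_mul_cancel₀ _ (by positivity),
      mul_comm t]
    gcongr
    exact Nat.floor_le zero_le
  refine tendsto_nhdsWithin_iff.2 ⟨?_, Eventually.of_forall hle⟩
  refine tendsto_of_tendsto_of_tendsto_of_le_of_le tendsto_const_nhds ?_ hle hge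
  simpa using (tendsto_const_nhds (x := t)).add
    (tendsto_one_div_add_atTop_nhds_zero_nat (𝕜 := ℝ≥0))

/-- A process with measurable marginals and right-continuous paths is jointly measurable. -/
theorem measurable_of_continuousWithinAt_Ici {Ω β : Type*} [MeasurableSpace Ω]
    [TopologicalSpace β] [TopologicalSpace.PseudoMetrizableSpace β] [MeasurableSpace β]
    [BorelSpace β] {f : ℝ≥0 → Ω → β} (hf : ∀ t, Measurable (f t))
    (hc : ∀ ω t, ContinuousWithinAt (fun s => f s ω) (Ici t) t) :
    Measurable fun p : ℝ≥0 × Ω => f p.1 p.2 := by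
  -- `rightApprox k` takes countably many values, so each approximation factors through a process
  -- indexed by `ℕ`; right-continuity identifies the limit.
  refine measurable_of_tendsto_metrizable
    (f := fun k (p : ℝ≥0 × Ω) => f (rightApprox k p.1) p.2) (fun k => ?_) ?_
  · have h1 : Measurable fun q : ℕ × Ω => f (((q.1 : ℝ≥0) + 1) / ((k : ℝ≥0) + 1)) q.2 :=
      measurable_from_prod_countable_right fun m => hf (((m : ℝ≥0) + 1) / ((k : ℝ≥0) + 1))
    have h2 : Measurable fun p : ℝ≥0 × Ω => (⌊((k : ℝ≥0) + 1) * p.1⌋₊, p.2) := by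
      refine Measurable.prodMk ?_ measurable_snd
      exact Nat.measurable_floor.comp (measurable_const.mul measurable_fst)
    have h3 := h1.comp h2
    simp only [Function.comp_def] at h3
    simp only [rightApprox]
    exact h3
  · rw [tendsto_pi_nhds]
    exact fun p => (hc p.2 p.1).tendsto.comp (tendsto_rightApprox p.1)

theorem IsCadlag.measurable {f : ℝ≥0 → ℝ} (hf : IsCadlag f) : Measurable f := by
  have h : Measurable fun p : ℝ≥0 × Unit => f p.1 :=
    measurable_of_continuousWithinAt_Ici (f := fun t _ => f t) (fun _ => measurable_const)
      fun _ t => (hf t).1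
  exact h.comp (measurable_prodMk_right (y := ()))

/-- Local boundedness suffices, by compactness of `[0, T]`. Just to the left of `t` the path is
controlled by its left limit, and from `t` onwards by right-continuity. -/
theorem IsCadlag.exists_bound {f : ℝ≥0 → ℝ} (hf : IsCadlag f) (T : ℝ≥0) :
    ∃ M, ∀ t ≤ T, |f t| ≤ M := by
  have hbd : ∀ {l : Filter ℝ≥0} {a : ℝ}, Tendsto f l (𝓝 a) → ∀ᶠ r in l, |f r| ≤ |a| + 1 :=
    fun h => (h.abs.eventually_lt_const (lt_add_one _)).mono fun _ h => h.le
  have := (isCompact_Icc (a := 0) (b := T)).induction_on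
    (p := fun s => ∃ M, ∀ t ∈ s, |f t| ≤ M) ⟨0, by simp⟩
    (fun s t hst ⟨M, hM⟩ => ⟨M, fun r hr => hM r (hst hr)⟩)
    (fun s t ⟨M, hM⟩ ⟨N, hN⟩ => ⟨max M N, fun r hr => hr.elim
      (fun h => (hM r h).trans (le_max_left _ _)) fun h => (hN r h).trans (le_max_right _ _)⟩)
    (fun t _ => by
      obtain ⟨l, hl⟩ := (hf t).2
      refine ⟨{r | |f r| ≤ max (|f t| + 1) (|l| + 1)}, mem_nhdsWithin_of_mem_nhds ?_, _,
        fun r hr => hr⟩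
      rw [← nhdsLT_sup_nhdsGE]
      refine mem_sup.2 ⟨?_, ?_⟩
      · exact (hbd hl).mono fun r hr => hr.trans (le_max_right _ _)
      · exact (hbd (hf t).1.tendsto).mono fun r hr => hr.trans (le_max_left _ _))
  obtain ⟨M, hM⟩ := this
  exact ⟨M, fun t ht => hM t ⟨zero_le, ht⟩⟩

/-! ### The fluid system in terms of cumulative interaction counts -/

/-- Cumulative fluid of spreader-ignorant interactions. -/
def fluidA (lam : ℝ≥0 → ℝ≥0) (x y : ℝ≥0 → ℝ) (t : ℝ≥0) : ℝ :=
  ∫ s in Icc 0 t, (lam s : ℝ) * x s * y s ∂leb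

/-- Cumulative fluid of spreader-spreader interactions. -/
def fluidB (th : ℝ≥0 → ℝ≥0) (y : ℝ≥0 → ℝ) (t : ℝ≥0) : ℝ :=
  ∫ s in Icc 0 t, (th s : ℝ) * y s ^ 2 ∂leb

/-- Cumulative fluid of spreader-stifler interactions. -/
def fluidC (gam : ℝ≥0 → ℝ≥0) (u y z : ℝ≥0 → ℝ) (t : ℝ≥0) : ℝ :=
  ∫ s in Icc 0 t, (gam s : ℝ) * (u s + z s) * y s ∂leb

section
variable {lam th gam : ℝ≥0 → ℝ≥0} {δ β u₀ y₀ z₀ : ℝ} {x u y z : ℝ≥0 → ℝ}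

theorem integral_lam_mul (c : ℝ) (t : ℝ≥0) :
    ∫ s in Icc 0 t, (lam s : ℝ) * c * x s * y s ∂leb = c * fluidA lam x y t := by
  rw [fluidA, ← integral_const_mul]
  congr 1 with s
  ring

theorem integral_th_mul (c : ℝ) (t : ℝ≥0) :
    ∫ s in Icc 0 t, (th s : ℝ) * c * y s ^ 2 ∂leb = c * fluidB th y t := by
  rw [fluidB, ← integral_const_mul]
  congr 1 with s
  ring

/-- Two measurable paths bounded by `M` that both solve the fluid equations up to `ε`. -/
structure IsApproxFluid (lam th gam : ℝ≥0 → ℝ≥0) (δ β u₀ y₀ z₀ : ℝ) (T : ℝ≥0) (M ε : ℝ)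
    (x u y z : ℝ≥0 → ℝ) : Prop where
  meas_x : Measurable x
  meas_u : Measurable u
  meas_y : Measurable y
  meas_z : Measurable z
  bound_x : ∀ t ≤ T, |x t| ≤ M
  bound_u : ∀ t ≤ T, |u t| ≤ M
  bound_y : ∀ t ≤ T, |y t| ≤ M
  bound_z : ∀ t ≤ T, |z t| ≤ M
  approx_x : ∀ t ≤ T, |x t - (1 - u₀ - y₀ - z₀ - fluidA lam x y t)| ≤ ε
  approx_u : ∀ t ≤ T, |u t - (u₀ + (1 - δ) * fluidA lam x y t)| ≤ ε
  approx_y : ∀ t ≤ T, |y t - (y₀ + δ * fluidA lam x y t - (2 - β) * fluidB th y t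
    - fluidC gam u y z t)| ≤ ε
  approx_z : ∀ t ≤ T, |z t - (z₀ + (2 - β) * fluidB th y t + fluidC gam u y z t)| ≤ ε

theorem IsFluidSolution.isApproxFluid (h : IsFluidSolution lam th gam δ β u₀ y₀ z₀ x u y z)
    {T : ℝ≥0} {M ε : ℝ} (hε : 0 ≤ ε) (hx : ∀ t ≤ T, |x t| ≤ M) (hu : ∀ t ≤ T, |u t| ≤ M)
    (hy : ∀ t ≤ T, |y t| ≤ M) (hz : ∀ t ≤ T, |z t| ≤ M) :
    IsApproxFluid lam th gam δ β u₀ y₀ z₀ T M ε x u y z := by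
  have eu : ∀ t, u t = u₀ + (1 - δ) * fluidA lam x y t := fun t => by
    rw [h.eq_u, integral_lam_mul]
  have ey : ∀ t, y t = y₀ + δ * fluidA lam x y t - (2 - β) * fluidB th y t
      - fluidC gam u y z t := fun t => by
    rw [h.eq_y, integral_lam_mul, integral_th_mul, fluidC]
  have ez : ∀ t, z t = z₀ + (2 - β) * fluidB th y t + fluidC gam u y z t := fun t => by
    rw [h.eq_z, integral_th_mul, fluidC]
  refine ⟨h.cadlag_x.measurable, h.cadlag_u.measurable, h.cadlag_y.measurable,
    h.cadlag_z.measurable, hx, hu, hy, hz, fun t _ => ?_, fun t _ => ?_, fun t _ => ?_,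
    fun t _ => ?_⟩
  · rw [h.eq_x, eu, ey, ez]
    refine (le_of_eq ?_).trans hε
    rw [abs_eq_zero]
    ring
  · rw [← eu, sub_self, abs_zero]
    exact hε
  · rw [← ey, sub_self, abs_zero]
    exact hε
  · rw [← ez, sub_self, abs_zero]
    exact hε

/-! ### Stability and uniqueness for the fluid system. -/

theorem abs_integral_sub_le {f g d : ℝ≥0 → ℝ} {t : ℝ≥0} {L : ℝ}
    (hf : IntegrableOn f (Icc 0 t) leb) (hg : IntegrableOn g (Icc 0 t) leb)
    (hd : IntegrableOn d (Icc 0 t) leb) (h : ∀ s ≤ t, |f s - g s| ≤ L * d s) :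
    |(∫ s in Icc 0 t, f s ∂leb) - ∫ s in Icc 0 t, g s ∂leb| ≤ L * ∫ s in Icc 0 t, d s ∂leb := by
  rw [← integral_sub hf hg, ← integral_const_mul]
  refine norm_integral_le_of_norm_le (f := fun s => f s - g s) (hd.const_mul L) ?_
  filter_upwards [ae_restrict_mem measurableSet_Icc] with s hs
  exact h s hs.2

theorem abs_mul_le_of_le {a b M N : ℝ} (ha : |a| ≤ M) (hb : |b| ≤ N) : |a * b| ≤ M * N := by
  rw [abs_mul]
  exact mul_le_mul ha hb (abs_nonneg _) ((abs_nonneg _).trans ha)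

theorem abs_mul_sub_mul_le {a b a' b' M N : ℝ} (hb : |b| ≤ M) (ha' : |a'| ≤ N) :
    |a * b - a' * b'| ≤ M * |a - a'| + N * |b - b'| := by
  have : a * b - a' * b' = (a - a') * b + a' * (b - b') := by ring
  rw [this]
  refine (abs_add_le _ _).trans ?_
  rw [abs_mul, abs_mul, mul_comm |a - a'|]
  gcongr

/-- Grönwall stability of the fluid system under perturbations. -/
theorem IsApproxFluid.abs_sub_le {x' u' y' z' : ℝ≥0 → ℝ} {T : ℝ≥0} {M K ε : ℝ}
    (hlam : Measurable lam) (hth : Measurable th) (hgam : Measurable gam)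
    (hlamK : ∀ t, (lam t : ℝ) ≤ K) (hthK : ∀ t, (th t : ℝ) ≤ K) (hgamK : ∀ t, (gam t : ℝ) ≤ K)
    (hδ : δ ∈ Icc (0 : ℝ) 1) (hβ : β ∈ Icc (0 : ℝ) 1)
    (h : IsApproxFluid lam th gam δ β u₀ y₀ z₀ T M ε x u y z)
    (h' : IsApproxFluid lam th gam δ β u₀ y₀ z₀ T M ε x' u' y' z') (t : ℝ≥0) (ht : t ≤ T) :
    |x t - x' t| + |u t - u' t| + |y t - y' t| + |z t - z' t|
      ≤ 2 * (8 * ε) * Real.exp (2 * (18 * (K * M) + 1) * t) := by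
  have hM : 0 ≤ M := (abs_nonneg _).trans (h.bound_x 0 zero_le)
  have hK : 0 ≤ K := (NNReal.coe_nonneg _).trans (hlamK 0)
  have mlam : Measurable fun s => (lam s : ℝ) := measurable_coe_nnreal_real.comp hlam
  have mth : Measurable fun s => (th s : ℝ) := measurable_coe_nnreal_real.comp hth
  have mgam : Measurable fun s => (gam s : ℝ) := measurable_coe_nnreal_real.comp hgam
  have absK : ∀ {f : ℝ≥0 → ℝ≥0}, (∀ t, (f t : ℝ) ≤ K) → ∀ t, |(f t : ℝ)| ≤ K := fun hf t => by
    rw [abs_of_nonneg (NNReal.coe_nonneg _)]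
    exact hf t
  set d : ℝ≥0 → ℝ := fun t => |x t - x' t| + |u t - u' t| + |y t - y' t| + |z t - z' t| with hd
  have md : Measurable d := by
    have := h.meas_x; have := h.meas_u; have := h.meas_y; have := h.meas_z
    have := h'.meas_x; have := h'.meas_u; have := h'.meas_y; have := h'.meas_z
    fun_prop
  have bd : ∀ t ≤ T, d t ≤ 8 * M := by
    intro t ht
    have e1 := (abs_sub (x t) (x' t)).trans (add_le_add (h.bound_x t ht) (h'.bound_x t ht))
    have e2 := (abs_sub (u t) (u' t)).trans (add_le_add (h.bound_u t ht) (h'.bound_u t ht))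
    have e3 := (abs_sub (y t) (y' t)).trans (add_le_add (h.bound_y t ht) (h'.bound_y t ht))
    have e4 := (abs_sub (z t) (z' t)).trans (add_le_add (h.bound_z t ht) (h'.bound_z t ht))
    simp only [hd]
    linarith
  have d0 : ∀ t, 0 ≤ d t := fun t => by positivity
  have dint : ∀ t ≤ T, IntegrableOn d (Icc 0 t) leb := fun t ht =>
    integrableOn_leb_of_bounded md (K := 8 * M) fun s hs => by
      rw [abs_of_nonneg (d0 s)]
      exact bd s (hs.trans ht)
  have scale : ∀ {f : ℝ≥0 → ℝ≥0}, (∀ t, (f t : ℝ) ≤ K) → ∀ (s : ℝ≥0) {r : ℝ},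
      |r| ≤ 2 * M * d s → |(f s : ℝ) * r| ≤ 2 * (K * M) * d s := fun hf s r hr => by
    refine (abs_mul_le_of_le (absK hf s) hr).trans (le_of_eq ?_)
    ring
  have intA : ∀ {x u y z : ℝ≥0 → ℝ}, IsApproxFluid lam th gam δ β u₀ y₀ z₀ T M ε x u y z →
      ∀ t ≤ T, IntegrableOn (fun s => (lam s : ℝ) * x s * y s) (Icc 0 t) leb :=
    fun h t ht => integrableOn_leb_of_bounded ((mlam.mul h.meas_x).mul h.meas_y) fun s hs =>
      abs_mul_le_of_le (abs_mul_le_of_le (absK hlamK s) (h.bound_x s (hs.trans ht)))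
        (h.bound_y s (hs.trans ht))
  have intB : ∀ {x u y z : ℝ≥0 → ℝ}, IsApproxFluid lam th gam δ β u₀ y₀ z₀ T M ε x u y z →
      ∀ t ≤ T, IntegrableOn (fun s => (th s : ℝ) * y s ^ 2) (Icc 0 t) leb :=
    fun {x u y z} h t ht => by
      simp only [pow_two]
      exact integrableOn_leb_of_bounded (mth.mul (h.meas_y.mul h.meas_y)) fun s hs =>
        abs_mul_le_of_le (absK hthK s) (abs_mul_le_of_le (h.bound_y s (hs.trans ht))
          (h.bound_y s (hs.trans ht)))
  have intC : ∀ {x u y z : ℝ≥0 → ℝ}, IsApproxFluid lam th gam δ β u₀ y₀ z₀ T M ε x u y z →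
      ∀ t ≤ T, IntegrableOn (fun s => (gam s : ℝ) * (u s + z s) * y s) (Icc 0 t) leb :=
    fun h t ht => integrableOn_leb_of_bounded ((mgam.mul (h.meas_u.add h.meas_z)).mul h.meas_y)
      fun s hs => abs_mul_le_of_le (abs_mul_le_of_le (absK hgamK s)
        ((abs_add_le _ _).trans (add_le_add (h.bound_u s (hs.trans ht))
          (h.bound_z s (hs.trans ht))))) (h.bound_y s (hs.trans ht))
  have key : ∀ t ≤ T, d t ≤ 8 * ε + (18 * (K * M) + 1) * ∫ s in Icc 0 t, d s ∂leb := by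
    intro t ht
    set I := ∫ s in Icc 0 t, d s ∂leb with hI
    have I0 : 0 ≤ I := integral_nonneg d0
    set J := 2 * (K * M) * I with hJ
    have dA : |fluidA lam x y t - fluidA lam x' y' t| ≤ J := by
      refine abs_integral_sub_le (intA h t ht) (intA h' t ht) (dint t ht) fun s hs => ?_
      rw [mul_assoc, mul_assoc, ← mul_sub]
      refine scale hlamK s ((abs_mul_sub_mul_le (h.bound_y s (hs.trans ht))
        (h'.bound_x s (hs.trans ht))).trans ?_)
      simp only [hd]
      nlinarith [abs_nonneg (x s - x' s), abs_nonneg (u s - u' s), abs_nonneg (y s - y' s),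
        abs_nonneg (z s - z' s)]
    have dB : |fluidB th y t - fluidB th y' t| ≤ J := by
      refine abs_integral_sub_le (intB h t ht) (intB h' t ht) (dint t ht) fun s hs => ?_
      rw [← mul_sub, pow_two, pow_two]
      refine scale hthK s ((abs_mul_sub_mul_le (h.bound_y s (hs.trans ht))
        (h'.bound_y s (hs.trans ht))).trans ?_)
      simp only [hd]
      nlinarith [abs_nonneg (x s - x' s), abs_nonneg (u s - u' s), abs_nonneg (y s - y' s),
        abs_nonneg (z s - z' s)]
    have dC : |fluidC gam u y z t - fluidC gam u' y' z' t| ≤ J := by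
      refine abs_integral_sub_le (intC h t ht) (intC h' t ht) (dint t ht) fun s hs => ?_
      rw [mul_assoc, mul_assoc, ← mul_sub]
      refine scale hgamK s ((abs_mul_sub_mul_le (h.bound_y s (hs.trans ht))
        ((abs_add_le _ _).trans (add_le_add (h'.bound_u s (hs.trans ht))
          (h'.bound_z s (hs.trans ht))))).trans ?_)
      have e : |u s + z s - (u' s + z' s)| ≤ |u s - u' s| + |z s - z' s| := by
        rw [add_sub_add_comm]
        exact abs_add_le _ _
      have e' := mul_le_mul_of_nonneg_left e hM
      simp only [hd]
      nlinarith [abs_nonneg (x s - x' s), abs_nonneg (u s - u' s), abs_nonneg (y s - y' s),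
        abs_nonneg (z s - z' s)]
    have J0 : 0 ≤ J := (abs_nonneg _).trans dA
    have coef : ∀ {c r b : ℝ}, |c| ≤ b → |r| ≤ J → |c * r| ≤ b * J := abs_mul_le_of_le
    have b1 : |1 - δ| ≤ 1 := abs_le.2 ⟨by linarith [hδ.2], by linarith [hδ.1]⟩
    have b2 : |δ| ≤ 1 := abs_le.2 ⟨by linarith [hδ.1], hδ.2⟩
    have b3 : |2 - β| ≤ 2 := abs_le.2 ⟨by linarith [hβ.2], by linarith [hβ.1]⟩
    have ax := abs_le.1 (h.approx_x t ht)
    have au := abs_le.1 (h.approx_u t ht)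
    have ay := abs_le.1 (h.approx_y t ht)
    have az := abs_le.1 (h.approx_z t ht)
    have ax' := abs_le.1 (h'.approx_x t ht)
    have au' := abs_le.1 (h'.approx_u t ht)
    have ay' := abs_le.1 (h'.approx_y t ht)
    have az' := abs_le.1 (h'.approx_z t ht)
    have c1 := abs_le.1 (coef b1 dA)
    have c2 := abs_le.1 (coef b2 dA)
    have c3 := abs_le.1 (coef b3 dB)
    have c0 := abs_le.1 dA
    have c4 := abs_le.1 dC
    have ex : |x t - x' t| ≤ 2 * ε + J := abs_le.2 ⟨by linarith, by linarith⟩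
    have eu : |u t - u' t| ≤ 2 * ε + J := abs_le.2 ⟨by linarith, by linarith⟩
    have ey : |y t - y' t| ≤ 2 * ε + 4 * J := abs_le.2 ⟨by linarith, by linarith⟩
    have ez : |z t - z' t| ≤ 2 * ε + 3 * J := abs_le.2 ⟨by linarith, by linarith⟩
    simp only [hd]
    -- Each coordinate contributes `2 * ε`, and the multiples of `J` are `1 + 1 + 4 + 3 = 9`. Since
    -- `J = 2 * (K * M) * I`, this gives `18 * (K * M)`; the extra `1` in the constant only makes it
    -- strictly positive.
    calc _ ≤ 8 * ε + 9 * J := by linarith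
      _ ≤ _ := by rw [hJ]; linarith
  exact gronwall_leb (by positivity) md (fun t _ => d0 t) bd key t ht

/-- Uniqueness of the fluid solution. -/
theorem IsFluidSolution.unique {x' u' y' z' : ℝ≥0 → ℝ} {K : ℝ}
    (hlam : Measurable lam) (hth : Measurable th) (hgam : Measurable gam)
    (hlamK : ∀ t, (lam t : ℝ) ≤ K) (hthK : ∀ t, (th t : ℝ) ≤ K) (hgamK : ∀ t, (gam t : ℝ) ≤ K)
    (hδ : δ ∈ Icc (0 : ℝ) 1) (hβ : β ∈ Icc (0 : ℝ) 1)
    (h' : IsFluidSolution lam th gam δ β u₀ y₀ z₀ x' u' y' z')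
    (h : IsFluidSolution lam th gam δ β u₀ y₀ z₀ x u y z) :
    x' = x ∧ u' = u ∧ y' = y ∧ z' = z := by
  -- On `[0, T]` both càdlàg solutions are bounded, hence approximate solutions with a common bound
  -- and error `0`.
  have key : ∀ T, |x' T - x T| + |u' T - u T| + |y' T - y T| + |z' T - z T| ≤ 0 := by
    intro T
    have bnd : ∀ {x u y z : ℝ≥0 → ℝ}, IsFluidSolution lam th gam δ β u₀ y₀ z₀ x u y z →
        ∃ M, ∀ t ≤ T, |x t| ≤ M ∧ |u t| ≤ M ∧ |y t| ≤ M ∧ |z t| ≤ M := by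
      intro x u y z h
      obtain ⟨a, ha⟩ := h.cadlag_x.exists_bound T
      obtain ⟨b, hb⟩ := h.cadlag_u.exists_bound T
      obtain ⟨c, hc⟩ := h.cadlag_y.exists_bound T
      obtain ⟨e, he⟩ := h.cadlag_z.exists_bound T
      refine ⟨max (max a b) (max c e), fun t ht => ⟨?_, ?_, ?_, ?_⟩⟩
      · exact (ha t ht).trans (by simp)
      · exact (hb t ht).trans (by simp)
      · exact (hc t ht).trans (by simp)
      · exact (he t ht).trans (by simp)
    obtain ⟨M, hM⟩ := bnd h
    obtain ⟨M', hM'⟩ := bnd h'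
    have A := h.isApproxFluid (T := T) (M := max M M') le_rfl
      (fun t ht => (hM t ht).1.trans (le_max_left _ _))
      (fun t ht => (hM t ht).2.1.trans (le_max_left _ _))
      (fun t ht => (hM t ht).2.2.1.trans (le_max_left _ _))
      (fun t ht => (hM t ht).2.2.2.trans (le_max_left _ _))
    have A' := h'.isApproxFluid (T := T) (M := max M M') le_rfl
      (fun t ht => (hM' t ht).1.trans (le_max_right _ _))
      (fun t ht => (hM' t ht).2.1.trans (le_max_right _ _))
      (fun t ht => (hM' t ht).2.2.1.trans (le_max_right _ _))
      (fun t ht => (hM' t ht).2.2.2.trans (le_max_right _ _))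
    simpa using A'.abs_sub_le hlam hth hgam hlamK hthK hgamK hδ hβ A T le_rfl
  have eqz : ∀ T, x' T = x T ∧ u' T = u T ∧ y' T = y T ∧ z' T = z T := fun T => by
    have h1 := abs_nonneg (x' T - x T)
    have h2 := abs_nonneg (u' T - u T)
    have h3 := abs_nonneg (y' T - y T)
    have h4 := abs_nonneg (z' T - z T)
    have := key T
    refine ⟨?_, ?_, ?_, ?_⟩ <;> refine sub_eq_zero.1 (abs_eq_zero.1 (le_antisymm ?_ ?_)) <;>
      linarith
  exact ⟨funext fun T => (eqz T).1, funext fun T => (eqz T).2.1, funext fun T => (eqz T).2.2.1,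
    funext fun T => (eqz T).2.2.2⟩

/-! ### Existence of the fluid limit -/

/-- Truncation to the unit interval. -/
def clip (r : ℝ) : ℝ := max 0 (min 1 r)

theorem clip_nonneg (r : ℝ) : 0 ≤ clip r := le_max_left _ _

theorem clip_le_one (r : ℝ) : clip r ≤ 1 := max_le zero_le_one (min_le_left _ _)

theorem abs_clip_le_one (r : ℝ) : |clip r| ≤ 1 := by
  rw [abs_of_nonneg (clip_nonneg r)]
  exact clip_le_one r

theorem clip_of_nonpos {r : ℝ} (h : r ≤ 0) : clip r = 0 := max_eq_left ((min_le_right _ _).trans h)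

theorem clip_of_mem {r : ℝ} (h : r ∈ Icc (0 : ℝ) 1) : clip r = r := by
  rw [clip, min_eq_right h.2, max_eq_right h.1]

theorem abs_clip_sub_le (r s : ℝ) : |clip r - clip s| ≤ |r - s| :=
  (abs_max_sub_max_le_max 0 _ 0 _).trans (max_le (by simp) ((abs_min_sub_min_le_max 1 r 1 s).trans
    (by simp)))

theorem continuous_clip : Continuous clip := by unfold clip; fun_prop

/-- A continuous function on `[0, ∞)` that starts nonnegative and is constant on any interval on
which it is negative remains nonnegative. -/
theorem nonneg_of_const_of_neg {f : ℝ≥0 → ℝ} (hf : Continuous f) (h0 : 0 ≤ f 0)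
    (h : ∀ s t, s ≤ t → (∀ r ∈ Ioc s t, f r < 0) → f t = f s) (t : ℝ≥0) : 0 ≤ f t := by
  by_contra hneg
  have hc : IsCompact (Icc 0 t ∩ f ⁻¹' Ici 0) :=
    isCompact_Icc.inter_right (isClosed_Ici.preimage hf)
  -- `s` is the last time before `t` at which `f` is nonnegative, so `f` is negative on `(s, t]` and
  -- therefore `f t = f s ≥ 0`.
  obtain ⟨s, ⟨hs, hs0⟩, hmax⟩ := hc.exists_isGreatest ⟨0, ⟨le_rfl, zero_le⟩, h0⟩
  refine hneg ?_
  rw [h s t hs.2 fun r hr => ?_]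
  · exact hs0
  · by_contra hr0
    exact (hmax ⟨⟨zero_le, hr.2⟩, not_lt.1 hr0⟩).not_gt hr.1

theorem exists_fluidSolution {K : ℝ}
    (hlam : Measurable lam) (hth : Measurable th) (hgam : Measurable gam)
    (hlamK : ∀ t, (lam t : ℝ) ≤ K) (hthK : ∀ t, (th t : ℝ) ≤ K) (hgamK : ∀ t, (gam t : ℝ) ≤ K)
    (hδ : δ ∈ Icc (0 : ℝ) 1) (hβ : β ∈ Icc (0 : ℝ) 1)
    (hu₀ : 0 ≤ u₀) (hy₀ : 0 ≤ y₀) (hz₀ : 0 ≤ z₀) (hsum : u₀ + y₀ + z₀ ≤ 1) :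
    ∃ x u y z : ℝ≥0 → ℝ, IsFluidSolution lam th gam δ β u₀ y₀ z₀ x u y z ∧
      ∀ t, x t ∈ Icc (0 : ℝ) 1 ∧ u t ∈ Icc (0 : ℝ) 1 ∧ y t ∈ Icc (0 : ℝ) 1 ∧
        z t ∈ Icc (0 : ℝ) 1 := by
  have hK : 0 ≤ K := (NNReal.coe_nonneg _).trans (hlamK 0)
  have mlam : Measurable fun s => (lam s : ℝ) := measurable_coe_nnreal_real.comp hlam
  have mth : Measurable fun s => (th s : ℝ) := measurable_coe_nnreal_real.comp hth
  have mgam : Measurable fun s => (gam s : ℝ) := measurable_coe_nnreal_real.comp hgam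
  have absK : ∀ {f : ℝ≥0 → ℝ≥0}, (∀ t, (f t : ℝ) ≤ K) → ∀ t, |(f t : ℝ)| ≤ K := fun hf t => by
    rw [abs_of_nonneg (NNReal.coe_nonneg _)]
    exact hf t
  -- The unknown `v` collects the cumulative counts of the three kinds of interaction; all four
  -- proportions are affine functions of it.
  let ex (v : Fin 3 → ℝ) : ℝ := 1 - u₀ - y₀ - z₀ - v 0
  let eu (v : Fin 3 → ℝ) : ℝ := u₀ + (1 - δ) * v 0
  let ey (v : Fin 3 → ℝ) : ℝ := y₀ + δ * v 0 - (2 - β) * v 1 - v 2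
  let ez (v : Fin 3 → ℝ) : ℝ := z₀ + (2 - β) * v 1 + v 2
  have cex : Continuous ex := by fun_prop
  have ceu : Continuous eu := by fun_prop
  have cey : Continuous ey := by fun_prop
  have cez : Continuous ez := by fun_prop
  let F (s : ℝ≥0) (v : Fin 3 → ℝ) : Fin 3 → ℝ :=
    ![lam s * (clip (ex v) * clip (ey v)), th s * (clip (ey v) * clip (ey v)),
      gam s * ((clip (eu v) + clip (ez v)) * clip (ey v))]
  have hmeas : ∀ v : ℝ≥0 → Fin 3 → ℝ, Continuous v → ∀ i, Measurable fun s => F s (v s) i := by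
    intro v hv i
    have cc := fun {e : (Fin 3 → ℝ) → ℝ} (he : Continuous e) =>
      (continuous_clip.comp (he.comp hv)).measurable
    fin_cases i
    · exact mlam.mul ((cc cex).mul (cc cey))
    · exact mth.mul ((cc cey).mul (cc cey))
    · exact mgam.mul (((cc ceu).add (cc cez)).mul (cc cey))
  have hb : ∀ s v i, |F s v i| ≤ K * (2 * 1) := by
    intro s v i
    fin_cases i
    · refine abs_mul_le_of_le (absK hlamK s) ((abs_mul_le_of_le (abs_clip_le_one _)
        (abs_clip_le_one _)).trans (by norm_num))
    · refine abs_mul_le_of_le (absK hthK s) ((abs_mul_le_of_le (abs_clip_le_one _)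
        (abs_clip_le_one _)).trans (by norm_num))
    · refine abs_mul_le_of_le (absK hgamK s) (abs_mul_le_of_le ((abs_add_le _ _).trans
        ((add_le_add (abs_clip_le_one _) (abs_clip_le_one _)).trans (by norm_num)))
        (abs_clip_le_one _))
  have hlip : ∀ s v w i, |F s v i - F s w i| ≤ (K * 12 + 1) * ‖v - w‖ := by
    intro s v w i
    set D := ‖v - w‖ with hD
    have hD0 : 0 ≤ D := norm_nonneg _
    have hv : ∀ i, |v i - w i| ≤ D := fun i => norm_le_pi_norm (v - w) i
    have b1 : |1 - δ| ≤ 1 := abs_le.2 ⟨by linarith [hδ.2], by linarith [hδ.1]⟩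
    have b2 : |δ| ≤ 1 := abs_le.2 ⟨by linarith [hδ.1], hδ.2⟩
    have b3 : |2 - β| ≤ 2 := abs_le.2 ⟨by linarith [hβ.2], by linarith [hβ.1]⟩
    have a0 := abs_le.1 (hv 0)
    have a1 := abs_le.1 (abs_mul_le_of_le b1 (hv 0))
    have a2 := abs_le.1 (abs_mul_le_of_le b2 (hv 0))
    have a3 := abs_le.1 (abs_mul_le_of_le b3 (hv 1))
    have a4 := abs_le.1 (hv 2)
    have dx := (abs_clip_sub_le (ex v) (ex w)).trans
      (abs_le.2 ⟨by simp only [ex]; linarith, by simp only [ex]; linarith⟩ : _ ≤ D)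
    have du := (abs_clip_sub_le (eu v) (eu w)).trans
      (abs_le.2 ⟨by simp only [eu]; linarith, by simp only [eu]; linarith⟩ : _ ≤ D)
    have dy := (abs_clip_sub_le (ey v) (ey w)).trans
      (abs_le.2 ⟨by simp only [ey]; linarith, by simp only [ey]; linarith⟩ : _ ≤ 4 * D)
    have dz := (abs_clip_sub_le (ez v) (ez w)).trans
      (abs_le.2 ⟨by simp only [ez]; linarith, by simp only [ez]; linarith⟩ : _ ≤ 3 * D)
    -- The worst component is the third: `1 * (D + 3 * D)` from the variation of the sum and `2 * (4
    -- * D)` from that of the spreaders, in total `12 * D`.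
    have fin : ∀ {f : ℝ≥0 → ℝ≥0}, (∀ t, (f t : ℝ) ≤ K) → ∀ {r : ℝ}, |r| ≤ 12 * D →
        |(f s : ℝ) * r| ≤ (K * 12 + 1) * D := fun hf r hr => by
      refine (abs_mul_le_of_le (absK hf s) hr).trans ?_
      linarith
    fin_cases i
    · change |(lam s : ℝ) * _ - lam s * _| ≤ _
      rw [← mul_sub]
      refine fin hlamK ((abs_mul_sub_mul_le (abs_clip_le_one _) (abs_clip_le_one _)).trans ?_)
      linarith
    · change |(th s : ℝ) * _ - th s * _| ≤ _
      rw [← mul_sub]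
      refine fin hthK ((abs_mul_sub_mul_le (abs_clip_le_one _) (abs_clip_le_one _)).trans ?_)
      linarith
    · change |(gam s : ℝ) * _ - gam s * _| ≤ _
      rw [← mul_sub]
      refine fin hgamK ((abs_mul_sub_mul_le (abs_clip_le_one _) ((abs_add_le _ _).trans
        (add_le_add (abs_clip_le_one _) (abs_clip_le_one _)))).trans ?_)
      have : |clip (eu v) + clip (ez v) - (clip (eu w) + clip (ez w))| ≤ D + 3 * D := by
        rw [add_sub_add_comm]
        exact (abs_add_le _ _).trans (add_le_add du dz)
      linarith
  obtain ⟨v, hv, hveq⟩ := exists_integral_solution F hmeas (by positivity) hb hlip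
  have hstep : ∀ s t i, s ≤ t → (∀ r ∈ Ioc s t, F r (v r) i = 0) → v t i = v s i := by
    intro s t i hst h
    rw [hveq, hveq, integral_leb_add_Ioc hst
      (integrableOn_leb_of_bounded (hmeas v hv i) fun r _ => hb r (v r) i),
      setIntegral_eq_zero_of_forall_eq_zero h, add_zero]
  have hF0 : ∀ s v i, 0 ≤ F s v i := by
    intro s v i
    have := clip_nonneg
    fin_cases i
    · exact mul_nonneg (NNReal.coe_nonneg _) (mul_nonneg (this _) (this _))
    · exact mul_nonneg (NNReal.coe_nonneg _) (mul_nonneg (this _) (this _))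
    · exact mul_nonneg (NNReal.coe_nonneg _)
        (mul_nonneg (add_nonneg (this _) (this _)) (this _))
  have hv0 : ∀ t i, 0 ≤ v t i := fun t i => by
    rw [hveq]
    exact integral_nonneg fun s => hF0 _ _ _
  have hvz : ∀ i, v 0 i = 0 := fun i => by
    rw [hveq]
    simp
  -- While `ex` is negative the clipped rate of the first component vanishes, so `ex` is constant.
  -- For `ey` below, all three rates vanish. The other two proportions are nonnegative because `v`
  -- is, and since the four sum to `1`, each lies in `[0, 1]`.
  have hx : ∀ t, 0 ≤ ex (v t) := by
    refine nonneg_of_const_of_neg (cex.comp hv) ?_ fun s t hst h => ?_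
    · simp only [ex, hvz]
      linarith
    · simp only [ex]
      rw [hstep s t 0 hst fun r hr => ?_]
      simp [F, clip_of_nonpos (h r hr).le]
  have hy : ∀ t, 0 ≤ ey (v t) := by
    refine nonneg_of_const_of_neg (cey.comp hv) ?_ fun s t hst h => ?_
    · simp only [ey, hvz]
      linarith
    · simp only [ey]
      rw [hstep s t 0 hst fun r hr => ?_, hstep s t 1 hst fun r hr => ?_,
        hstep s t 2 hst fun r hr => ?_] <;> simp [F, clip_of_nonpos (h r hr).le]
  have hu : ∀ t, 0 ≤ eu (v t) := fun t =>
    add_nonneg hu₀ (mul_nonneg (by linarith [hδ.2]) (hv0 t 0))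
  have hz : ∀ t, 0 ≤ ez (v t) := fun t =>
    add_nonneg (add_nonneg hz₀ (mul_nonneg (by linarith [hβ.2]) (hv0 t 1))) (hv0 t 2)
  have htot : ∀ t, ex (v t) = 1 - eu (v t) - ey (v t) - ez (v t) := fun t => by
    simp only [ex, eu, ey, ez]
    ring
  have mem : ∀ t, ex (v t) ∈ Icc (0 : ℝ) 1 ∧ eu (v t) ∈ Icc (0 : ℝ) 1 ∧
      ey (v t) ∈ Icc (0 : ℝ) 1 ∧ ez (v t) ∈ Icc (0 : ℝ) 1 := fun t => by
    have := htot t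
    have := hx t
    have := hy t
    have := hu t
    have := hz t
    refine ⟨⟨hx t, ?_⟩, ⟨hu t, ?_⟩, ⟨hy t, ?_⟩, ⟨hz t, ?_⟩⟩ <;> linarith
  have hA : ∀ t, v t 0 = fluidA lam (fun s => ex (v s)) (fun s => ey (v s)) t := fun t => by
    rw [hveq, fluidA]
    congr 1 with s
    change (lam s : ℝ) * (clip (ex (v s)) * clip (ey (v s))) = _
    rw [clip_of_mem (mem s).1, clip_of_mem (mem s).2.2.1, mul_assoc]
  have hB : ∀ t, v t 1 = fluidB th (fun s => ey (v s)) t := fun t => by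
    rw [hveq, fluidB]
    congr 1 with s
    change (th s : ℝ) * (clip (ey (v s)) * clip (ey (v s))) = _
    rw [clip_of_mem (mem s).2.2.1, pow_two]
  have hC : ∀ t, v t 2 = fluidC gam (fun s => eu (v s)) (fun s => ey (v s))
      (fun s => ez (v s)) t := fun t => by
    rw [hveq, fluidC]
    congr 1 with s
    change (gam s : ℝ) * ((clip (eu (v s)) + clip (ez (v s))) * clip (ey (v s))) = _
    rw [clip_of_mem (mem s).2.1, clip_of_mem (mem s).2.2.1, clip_of_mem (mem s).2.2.2, mul_assoc]
  refine ⟨fun t => ex (v t), fun t => eu (v t), fun t => ey (v t), fun t => ez (v t),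
    ⟨(cex.comp hv).isCadlag, (ceu.comp hv).isCadlag, (cey.comp hv).isCadlag,
      (cez.comp hv).isCadlag, htot, fun t => ?_, fun t => ?_, fun t => ?_⟩, mem⟩
  · rw [integral_lam_mul, ← hA]
  · rw [integral_lam_mul, integral_th_mul, ← hA, ← hB]
    change _ = _ - fluidC gam _ _ _ t
    rw [← hC]
  · rw [integral_th_mul, ← hB]
    change _ = _ + fluidC gam _ _ _ t
    rw [← hC]

end

/-! ### Paths of counting processes -/

section Counting
variable {Ω : Type*} {N : ℝ≥0 → Ω → ℕ}

/-- The infimum defining `epoch` is attained: an integer-valued right-continuous path is constant on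
a short interval to the right of it, and that interval contains a time at which the level is already
reached. -/
theorem IsCountingProcess.epoch_le_iff (hN : IsCountingProcess N) {i : ℕ} {ω : Ω}
    (h : ∃ t, i + 1 ≤ N t ω) (t : ℝ≥0) : epoch N i ω ≤ t ↔ i + 1 ≤ N t ω := by
  refine ⟨fun hle => ?_, fun ht => csInf_le (OrderBot.bddBelow _) ht⟩
  suffices i + 1 ≤ N (epoch N i ω) ω from this.trans (hN.mono ω hle)
  have hev : ∀ᶠ s in 𝓝[≥] epoch N i ω, N s ω = N (epoch N i ω) ω := by
    have := (hN.rightCts ω (epoch N i ω)).tendsto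
    rw [nhds_discrete, tendsto_pure] at this
    exact this
  obtain ⟨b, hb, hsub⟩ := (mem_nhdsGE_iff_exists_Ico_subset).1 hev
  obtain ⟨s, hs, hsb⟩ := exists_lt_of_csInf_lt h hb
  have h1 : epoch N i ω ≤ s := csInf_le (OrderBot.bddBelow _) hs
  have h2 : N s ω = N (epoch N i ω) ω := hsub ⟨h1, hsb⟩
  rw [← h2]
  exact hs

theorem IsCountingProcess.le_of_lt_epoch (hN : IsCountingProcess N) {i : ℕ} {ω : Ω}
    (h : ∃ t, i + 1 ≤ N t ω) {s : ℝ≥0} (hs : s < epoch N i ω) : N s ω ≤ i := by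
  by_contra hlt
  exact hs.not_ge ((hN.epoch_le_iff h s).2 (by omega))

/-- This is where jumps of size one enter: a larger jump could skip level `i`. The epoch is positive
because the path starts at `0`. -/
theorem IsCountingProcess.exists_lt_epoch (hN : IsCountingProcess N) {i : ℕ} {ω : Ω}
    (h : ∃ t, i + 1 ≤ N t ω) : ∃ s < epoch N i ω, i ≤ N s ω := by
  have h1 := (hN.epoch_le_iff h _).1 le_rfl
  have hpos : 0 < epoch N i ω := by
    rw [pos_iff_ne_zero]
    intro h0
    rw [h0, hN.zero] at h1
    omega
  obtain ⟨s, hs, hs'⟩ := hN.unitJumps ω _ hpos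
  exact ⟨s, hs, by omega⟩

theorem IsCountingProcess.countingIntegral_eq_sum (hN : IsCountingProcess N)
    {C : ℝ≥0 → Ω → ℝ≥0} {t : ℝ≥0} {ω : Ω} (hC : ∀ s, t < s → C s ω = 0) :
    countingIntegral C N ω = ∑ i ∈ Finset.range (N t ω), (C (epoch N i ω) ω : ℝ≥0∞) := by
  rw [countingIntegral, tsum_eq_sum (s := Finset.range (N t ω))]
  · refine Finset.sum_congr rfl fun i hi => if_pos ⟨t, ?_⟩
    exact Finset.mem_range.1 hi
  · intro i hi
    split_ifs with h
    · rw [hC _ (not_le.1 fun hle => hi (Finset.mem_range.2 ((hN.epoch_le_iff h t).1 hle))),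
        ENNReal.coe_zero]
    · rfl

/-- The left limit of a counting process, as a supremum over a countable dense set of times. -/
def leftValue (N : ℝ≥0 → Ω → ℕ) (s : ℝ≥0) (ω : Ω) : ℝ≥0∞ :=
  ⨆ k : ℕ, if TopologicalSpace.denseSeq ℝ≥0 k < s then
    (N (TopologicalSpace.denseSeq ℝ≥0 k) ω : ℝ≥0∞) else 0

theorem IsCountingProcess.leftValue_le (hN : IsCountingProcess N) (s : ℝ≥0) (ω : Ω) :
    leftValue N s ω ≤ N s ω := by
  refine iSup_le fun k => ?_
  split_ifs with h
  · exact_mod_cast hN.mono ω h.le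
  · exact zero_le

/-- Before the epoch the path is at most `i`, and by unit jumps it equals `i` from some earlier time
on; density supplies a sampling time in between. -/
theorem IsCountingProcess.leftValue_epoch (hN : IsCountingProcess N) {i : ℕ} {ω : Ω}
    (h : ∃ t, i + 1 ≤ N t ω) : leftValue N (epoch N i ω) ω = i := by
  refine le_antisymm (iSup_le fun k => ?_) ?_
  · split_ifs with hk
    · exact_mod_cast hN.le_of_lt_epoch h hk
    · exact zero_le
  · obtain ⟨s, hs, hi⟩ := hN.exists_lt_epoch h
    obtain ⟨_, ⟨k, rfl⟩, hk⟩ :=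
      (TopologicalSpace.denseRange_denseSeq ℝ≥0).exists_between hs
    refine le_trans ?_ (le_iSup _ k)
    rw [if_pos hk.2]
    exact_mod_cast hi.trans (hN.mono ω hk.1.le)

end Counting

/-! ### Measurability of predictable and progressive processes -/

section Measurability
variable {Ω : Type*} [mΩ : MeasurableSpace Ω] {𝓕 : Filtration ℝ≥0 mΩ}

/-- A value known at time `q` and used only after `q` is predictable. These are the building blocks
of both integrands in the second-moment estimate. -/
theorem measurable_predictable_ite {q : ℝ≥0} {f : Ω → ℝ≥0∞} (hf : Measurable[𝓕 q] f) :
    Measurable[𝓕.predictable] fun p : ℝ≥0 × Ω => if q < p.1 then f p.2 else 0 := by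
  intro B hB
  have h1 : MeasurableSet[𝓕.predictable] (Ioi q ×ˢ (f ⁻¹' B)) :=
    measurableSet_predictable_Ioi_prod (hf hB)
  have h2 : MeasurableSet[𝓕.predictable] (Ioi q ×ˢ (univ : Set Ω)) :=
    measurableSet_predictable_Ioi_prod MeasurableSet.univ
  by_cases h0 : (0 : ℝ≥0∞) ∈ B
  · have : (fun p : ℝ≥0 × Ω => if q < p.1 then f p.2 else 0) ⁻¹' B
        = Ioi q ×ˢ (f ⁻¹' B) ∪ (Ioi q ×ˢ (univ : Set Ω))ᶜ := by
      ext p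
      by_cases hp : q < p.1 <;> simp [hp, h0]
    rw [this]
    exact MeasurableSet.union h1 h2.compl
  · have : (fun p : ℝ≥0 × Ω => if q < p.1 then f p.2 else 0) ⁻¹' B = Ioi q ×ˢ (f ⁻¹' B) := by
      ext p
      by_cases hp : q < p.1 <;> simp [hp, h0]
    rw [this]
    exact h1

theorem measurableSet_predictable_le (t : ℝ≥0) :
    MeasurableSet[𝓕.predictable] {p : ℝ≥0 × Ω | p.1 ≤ t} := by
  have h2 : MeasurableSet[𝓕.predictable] (Ioi t ×ˢ (univ : Set Ω)) :=
    measurableSet_predictable_Ioi_prod MeasurableSet.univ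
  have : {p : ℝ≥0 × Ω | p.1 ≤ t} = (Ioi t ×ˢ (univ : Set Ω))ᶜ := by
    ext p
    simp
  rw [this]
  exact h2.compl

/-- Stated, like the next lemma, for an arbitrary measurable space so that the predictable σ-algebra
can be supplied explicitly. -/
theorem stronglyMeasurable_ite_toNNReal {α : Type*} {m : MeasurableSpace α} {f : α → ℝ≥0∞}
    (hf : Measurable f) {p : α → Prop} [DecidablePred p] (hp : MeasurableSet {a | p a}) :
    StronglyMeasurable fun a => if p a then (f a).toNNReal else 0 :=
  (Measurable.ite hp hf.ennreal_toNNReal measurable_const).stronglyMeasurable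

theorem measurable_two_mul_iSup_add_one {α : Type*} {m : MeasurableSpace α} {f : ℕ → α → ℝ≥0∞}
    (hf : ∀ k, Measurable (f k)) : Measurable fun a => 2 * (⨆ k, f k a) + 1 :=
  ((Measurable.iSup hf).const_mul 2).add_const 1

/-- Stopping time at `k` reduces to progressive measurability on `[0, k]`; at each point the stopped
values are eventually equal to the original one. -/
theorem MeasureTheory.IsProgressive.measurable_uncurry {u : ℝ≥0 → Ω → ℝ} (hu : IsProgressive 𝓕 u) :
    Measurable (Function.uncurry u) := by
  refine measurable_of_tendsto_metrizable
    (f := fun (k : ℕ) (p : ℝ≥0 × Ω) => u (min p.1 k) p.2) (fun k => ?_) ?_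
  · have h1 : @Measurable (ℝ≥0 × Ω) (Iic (k : ℝ≥0) × Ω) _
        (Subtype.instMeasurableSpace.prod (𝓕 k))
        fun p => (⟨min p.1 k, mem_Iic.2 (min_le_right _ _)⟩, p.2) := by
      refine @Measurable.prodMk _ _ _ _ _ (𝓕 k) _ _ ?_ ?_
      · exact (measurable_fst.min measurable_const).subtype_mk
      · exact measurable_snd.mono le_rfl (𝓕.le k)
    exact (hu k).comp h1
  · rw [tendsto_pi_nhds]
    rintro ⟨s, ω⟩
    refine tendsto_const_nhds.congr' ?_
    obtain ⟨m, hm⟩ := exists_nat_ge s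
    filter_upwards [eventually_ge_atTop m] with k hk
    have : s ≤ (k : ℝ≥0) := hm.trans (by exact_mod_cast hk)
    simp [Function.uncurry, min_eq_left this]

end Measurability

/-! ### The second moment of a compensated counting process -/

/-- The square `[0, t]²` splits along its diagonal into two triangles of equal integral, by Tonelli;
the diagonal itself is null. -/
theorem lintegral_sq_eq_two_mul {L : ℝ≥0 → ℝ≥0∞} (hL : Measurable L) (t : ℝ≥0) :
    (∫⁻ s in Icc 0 t, L s ∂leb) ^ 2
      = 2 * ∫⁻ r in Icc 0 t, L r * ∫⁻ s in Ioc r t, L s ∂leb ∂leb := by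
  have hsplit : ∀ r ∈ Icc 0 t, ∫⁻ s in Icc 0 t, L s ∂leb
      = (∫⁻ s in Icc 0 r, L s ∂leb) + ∫⁻ s in Ioc r t, L s ∂leb := by
    intro r hr
    rw [← lintegral_union measurableSet_Ioc
      (disjoint_left.2 fun x hx hx' => hx'.1.not_ge hx.2), Icc_union_Ioc_eq_Icc hr.1 hr.2]
  have hind : ∀ r ∈ Icc 0 t, L r * ∫⁻ s in Icc 0 r, L s ∂leb
      = ∫⁻ s in Icc 0 t, (if s ≤ r then L r * L s else 0) ∂leb := by
    intro r hr
    have : Icc 0 r = Iic r ∩ Icc 0 t := by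
      ext x
      simp only [mem_Icc, mem_inter_iff, mem_Iic]
      exact ⟨fun h => ⟨h.2, h.1, h.2.trans hr.2⟩, fun h => ⟨h.2.1, h.1⟩⟩
    rw [← lintegral_const_mul _ hL, this, ← Measure.restrict_restrict measurableSet_Iic,
      ← lintegral_indicator measurableSet_Iic]
    rfl
  have hind' : ∀ s ∈ Icc 0 t, ∫⁻ r in Icc 0 t, (if s ≤ r then L r * L s else 0) ∂leb
      = L s * ∫⁻ r in Ioc s t, L r ∂leb := by
    intro s hs
    have : Icc s t = Ici s ∩ Icc 0 t := by
      ext x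
      simp only [mem_Icc, mem_inter_iff, mem_Ici]
      exact ⟨fun h => ⟨h.1, zero_le, h.2⟩, fun h => ⟨h.1, h.2.2⟩⟩
    rw [setLIntegral_congr Ioc_ae_eq_Icc, ← lintegral_const_mul _ hL, this,
      ← Measure.restrict_restrict measurableSet_Ici, ← lintegral_indicator measurableSet_Ici]
    refine lintegral_congr fun r => ?_
    simp only [indicator, mem_Ici]
    split_ifs
    · rw [mul_comm]
    · rfl
  have hswap : ∫⁻ r in Icc 0 t, L r * ∫⁻ s in Icc 0 r, L s ∂leb ∂leb
      = ∫⁻ r in Icc 0 t, L r * ∫⁻ s in Ioc r t, L s ∂leb ∂leb := by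
    rw [setLIntegral_congr_fun measurableSet_Icc hind, lintegral_lintegral_swap,
      setLIntegral_congr_fun measurableSet_Icc hind']
    refine (Measurable.ite (measurableSet_le measurable_snd measurable_fst) ?_
      measurable_const).aemeasurable
    exact (hL.comp measurable_fst).mul (hL.comp measurable_snd)
  have hm1 : Measurable fun r => L r * ∫⁻ s in Icc 0 r, L s ∂leb := by
    refine hL.mul (Monotone.measurable fun a b hab => ?_)
    exact lintegral_mono_set (Icc_subset_Icc_right hab)
  rw [pow_two, ← lintegral_mul_const _ hL]
  rw [setLIntegral_congr_fun (g := fun r => (L r * ∫⁻ s in Icc 0 r, L s ∂leb)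
    + L r * ∫⁻ s in Ioc r t, L s ∂leb) measurableSet_Icc fun r hr => by
      simp only []
      rw [hsplit r hr, mul_add], lintegral_add_left hm1, hswap, two_mul]

section SecondMoment
variable {Ω : Type*} [mΩ : MeasurableSpace Ω] {P : Measure Ω}
  {𝓕 : Filtration ℝ≥0 mΩ} {N : ℝ≥0 → Ω → ℕ} {ℓ : ℝ≥0 → Ω → ℝ}

theorem HasStochasticIntensity.measurable_ofReal (h : HasStochasticIntensity P 𝓕 N ℓ) :
    Measurable fun p : ℝ≥0 × Ω => ENNReal.ofReal (ℓ p.1 p.2) :=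
  h.progressive.measurable_uncurry.ennreal_ofReal

theorem HasStochasticIntensity.measurable_natCast (h : HasStochasticIntensity P 𝓕 N ℓ)
    (t : ℝ≥0) : Measurable fun ω => (N t ω : ℝ≥0∞) :=
  measurable_from_nat.comp ((h.adapted t).mono (𝓕.le t) le_rfl)

/-- The integrand is `2 N(s-) + 1` up to time `t`. It equals `2 * i + 1` at the epoch with index
`i`, and the sum of the first `N t` odd numbers is `(N t) ^ 2`. On the intensity side the left limit
is bounded by the value itself. -/
theorem HasStochasticIntensity.lintegral_sq_le (h : HasStochasticIntensity P 𝓕 N ℓ) (t : ℝ≥0) :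
    ∫⁻ ω, (N t ω : ℝ≥0∞) ^ 2 ∂P
      ≤ ∫⁻ ω, ∫⁻ s in Icc 0 t, (2 * (N s ω : ℝ≥0∞) + 1) * ENNReal.ofReal (ℓ s ω) ∂leb ∂P := by
  have hN := h.counting
  let C : ℝ≥0 → Ω → ℝ≥0 := fun s ω => if s ≤ t then (2 * leftValue N s ω + 1).toNNReal else 0
  have hC : IsStronglyPredictable 𝓕 C := by
    refine @stronglyMeasurable_ite_toNNReal _ 𝓕.predictable _
      (@measurable_two_mul_iSup_add_one _ 𝓕.predictable _ fun k =>
        measurable_predictable_ite (𝓕 := 𝓕) (q := TopologicalSpace.denseSeq ℝ≥0 k)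
          (f := fun ω => (N (TopologicalSpace.denseSeq ℝ≥0 k) ω : ℝ≥0∞))
          (measurable_from_nat.comp (h.adapted _))) (fun p => p.1 ≤ t) _
      (measurableSet_predictable_le t)
  have hfin : ∀ s ω, 2 * leftValue N s ω + 1 ≠ ∞ := fun s ω => by
    have : leftValue N s ω ≠ ∞ := ((hN.leftValue_le s ω).trans_lt (ENNReal.natCast_lt_top _)).ne
    finiteness
  have hint : ∀ ω, countingIntegral C N ω = (N t ω : ℝ≥0∞) ^ 2 := by
    intro ω
    rw [hN.countingIntegral_eq_sum (t := t) fun s hs => if_neg hs.not_ge]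
    have : ∀ i ∈ Finset.range (N t ω), (C (epoch N i ω) ω : ℝ≥0∞) = ((2 * i + 1 : ℕ) : ℝ≥0∞) := by
      intro i hi
      have hi' : i + 1 ≤ N t ω := Finset.mem_range.1 hi
      simp only [C]
      rw [if_pos ((hN.epoch_le_iff ⟨t, hi'⟩ t).2 hi'), ENNReal.coe_toNNReal (hfin _ _),
        hN.leftValue_epoch ⟨t, hi'⟩]
      push_cast
      rfl
    rw [Finset.sum_congr rfl this, ← Nat.cast_sum, ← Nat.cast_pow]
    congr 1
    generalize N t ω = k
    induction k with
    | zero => rfl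
    | succ k ih => rw [Finset.sum_range_succ, ih]; ring
  rw [← lintegral_congr hint, h.intensity C hC]
  refine lintegral_mono fun ω => ?_
  rw [← lintegral_indicator measurableSet_Icc]
  refine lintegral_mono fun s => ?_
  simp only [C, indicator, mem_Icc, zero_le, true_and]
  split_ifs with hs
  · rw [ENNReal.coe_toNNReal (hfin _ _)]
    gcongr
    exact hN.leftValue_le s ω
  · simp

/-- The integrand is the value of `ℓ` at time `r`, kept constant on `(r, t]`; it is predictable
because it is known at time `r`. Its integral against `N` is that value times the increment `N t - N
r`. -/
theorem HasStochasticIntensity.lintegral_intensity_mul (h : HasStochasticIntensity P 𝓕 N ℓ)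
    {r t : ℝ≥0} (hrt : r ≤ t) :
    ∫⁻ ω, ENNReal.ofReal (ℓ r ω) * N t ω ∂P
      = (∫⁻ ω, ENNReal.ofReal (ℓ r ω) * N r ω ∂P)
        + ∫⁻ ω, ENNReal.ofReal (ℓ r ω) * ∫⁻ s in Ioc r t, ENNReal.ofReal (ℓ s ω) ∂leb ∂P := by
  have hN := h.counting
  have hmℓ : Measurable[𝓕 r] fun ω => ENNReal.ofReal (ℓ r ω) :=
    ENNReal.measurable_ofReal.comp (h.progressive.adapted r)
  let C : ℝ≥0 → Ω → ℝ≥0 := fun s ω =>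
    if s ≤ t then (if r < s then ENNReal.ofReal (ℓ r ω) else 0).toNNReal else 0
  have hC : IsStronglyPredictable 𝓕 C :=
    @stronglyMeasurable_ite_toNNReal _ 𝓕.predictable _
      (measurable_predictable_ite (𝓕 := 𝓕) hmℓ) (fun p => p.1 ≤ t) _
      (measurableSet_predictable_le t)
  have hCval : ∀ s ω, (C s ω : ℝ≥0∞) = (Ioc r t).indicator (fun _ => ENNReal.ofReal (ℓ r ω)) s := by
    intro s ω
    simp only [C, indicator, mem_Ioc]
    by_cases h1 : s ≤ t <;> by_cases h2 : r < s <;> simp [h1, h2, ENNReal.ofReal]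
  have hint : ∀ ω, ENNReal.ofReal (ℓ r ω) * N t ω
      = ENNReal.ofReal (ℓ r ω) * N r ω + countingIntegral C N ω := by
    intro ω
    rw [hN.countingIntegral_eq_sum (t := t) fun s hs => if_neg hs.not_ge]
    have : ∀ i ∈ Finset.range (N t ω), (C (epoch N i ω) ω : ℝ≥0∞)
        = if i < N r ω then 0 else ENNReal.ofReal (ℓ r ω) := by
      intro i hi
      have hi' : i + 1 ≤ N t ω := Finset.mem_range.1 hi
      have h1 := (hN.epoch_le_iff ⟨t, hi'⟩ t).2 hi'
      have h2 := hN.epoch_le_iff ⟨t, hi'⟩ r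
      rw [hCval]
      simp only [indicator, mem_Ioc, h1, and_true]
      by_cases h3 : i < N r ω
      · rw [if_pos h3, if_neg (h2.2 h3).not_gt]
      · rw [if_neg h3, if_pos (not_le.1 fun hle => h3 (h2.1 hle))]
    rw [Finset.sum_congr rfl this]
    have hle : N r ω ≤ N t ω := hN.mono ω hrt
    rw [← Finset.sum_range_add_sum_Ico _ hle, Finset.sum_eq_zero fun i hi => if_pos
      (Finset.mem_range.1 hi), Finset.sum_congr rfl fun i hi => if_neg
      (Finset.mem_Ico.1 hi).1.not_gt, Finset.sum_const, Nat.card_Ico, zero_add, nsmul_eq_mul,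
      mul_comm _ (ENNReal.ofReal _), ← mul_add, ← Nat.cast_add, Nat.add_sub_cancel' hle]
  have hmr : Measurable fun ω => ENNReal.ofReal (ℓ r ω) * N r ω :=
    (hmℓ.mono (𝓕.le r) le_rfl).mul (h.measurable_natCast r)
  rw [lintegral_congr hint, lintegral_add_left hmr, h.intensity C hC]
  congr 1
  refine lintegral_congr fun ω => ?_
  have hmω : Measurable fun s => ENNReal.ofReal (ℓ s ω) :=
    h.measurable_ofReal.comp measurable_prodMk_right
  rw [← lintegral_const_mul _ hmω, ← lintegral_indicator measurableSet_Ioc]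
  refine lintegral_congr fun s => ?_
  rw [hCval]
  simp only [indicator]
  split_ifs <;> simp

/-- `E (N(t) - ∫₀ᵗ ℓ)² ≤ E ∫₀ᵗ ℓ` for a bounded counting process with bounded intensity. -/
theorem HasStochasticIntensity.lintegral_sub_sq_le [IsProbabilityMeasure P]
    (h : HasStochasticIntensity P 𝓕 N ℓ) {n : ℕ} (hn : ∀ t ω, N t ω ≤ n) {κ : ℝ}
    (hκ : ∀ t ω, ℓ t ω ≤ κ) (t : ℝ≥0) :
    ∫⁻ ω, ENNReal.ofReal (((N t ω : ℝ) - ∫ s in Icc 0 t, ℓ s ω ∂leb) ^ 2) ∂P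
      ≤ ENNReal.ofReal (κ * t) := by
  have hm := h.measurable_ofReal
  have hmω : ∀ ω, Measurable fun s => ENNReal.ofReal (ℓ s ω) := fun ω =>
    hm.comp measurable_prodMk_right
  have hmN := h.measurable_natCast
  let Λ : Ω → ℝ≥0∞ := fun ω => ∫⁻ s in Icc 0 t, ENNReal.ofReal (ℓ s ω) ∂leb
  have hmΛ : Measurable Λ := hm.lintegral_prod_left'
  have hΛle : ∀ ω, Λ ω ≤ ENNReal.ofReal (κ * t) := fun ω => by
    refine (lintegral_mono fun s => ENNReal.ofReal_le_ofReal (hκ s ω)).trans (le_of_eq ?_)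
    rw [lintegral_const, Measure.restrict_apply_univ, leb_Icc, NNReal.coe_zero, sub_zero,
      ENNReal.ofReal_mul ((h.nonneg 0 ω).trans (hκ 0 ω))]
  have hΛfin : ∀ ω, Λ ω ≠ ∞ := fun ω => ((hΛle ω).trans_lt ENNReal.ofReal_lt_top).ne
  have hΛreal : ∀ ω, ∫ s in Icc 0 t, ℓ s ω ∂leb = (Λ ω).toReal := fun ω =>
    integral_eq_lintegral_of_nonneg_ae (ae_of_all _ fun s => h.nonneg s ω)
      (h.progressive.measurable_uncurry.comp measurable_prodMk_right).aestronglyMeasurable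
  -- The square is expanded with the cross term moved to the left, so that all terms are nonnegative
  -- and no integrability has to be discussed.
  have hpt : ∀ ω, ENNReal.ofReal (((N t ω : ℝ) - ∫ s in Icc 0 t, ℓ s ω ∂leb) ^ 2)
      + 2 * (N t ω * Λ ω) = (N t ω : ℝ≥0∞) ^ 2 + Λ ω ^ 2 := fun ω => by
    rw [hΛreal]
    generalize hx : (Λ ω).toReal = x
    have hx0 : 0 ≤ x := hx ▸ ENNReal.toReal_nonneg
    have hΛ : Λ ω = ENNReal.ofReal x := by rw [← hx, ENNReal.ofReal_toReal (hΛfin ω)]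
    rw [hΛ, ← ENNReal.ofReal_natCast, ← ENNReal.ofReal_mul (by positivity),
      ← ENNReal.ofReal_pow (by positivity), ← ENNReal.ofReal_pow hx0,
      ← ENNReal.ofReal_add (by positivity) (by positivity),
      show (2 : ℝ≥0∞) = ENNReal.ofReal 2 by simp, ← ENNReal.ofReal_mul (by positivity),
      ← ENNReal.ofReal_add (by positivity) (by positivity)]
    congr 1
    ring
  -- The expectations become `E Λ² = 2 I₂`, `E (N Λ) = I₁ + I₂` and `E N² ≤ 2 I₁ + E Λ`. Everything
  -- cancels except `E Λ`.
  let I₁ := ∫⁻ r in Icc 0 t, ∫⁻ ω, ENNReal.ofReal (ℓ r ω) * N r ω ∂P ∂leb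
  let I₂ := ∫⁻ r in Icc 0 t, ∫⁻ ω, ENNReal.ofReal (ℓ r ω)
    * ∫⁻ s in Ioc r t, ENNReal.ofReal (ℓ s ω) ∂leb ∂P ∂leb
  have hmtail : Measurable fun p : ℝ≥0 × Ω =>
      ENNReal.ofReal (ℓ p.1 p.2) * ∫⁻ s in Ioc p.1 t, ENNReal.ofReal (ℓ s p.2) ∂leb := by
    refine hm.mul ?_
    have : ∀ p : ℝ≥0 × Ω, ∫⁻ s in Ioc p.1 t, ENNReal.ofReal (ℓ s p.2) ∂leb
        = ∫⁻ s in Iic t, (if p.1 < s then ENNReal.ofReal (ℓ s p.2) else 0) ∂leb := fun p => by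
      rw [← Ioi_inter_Iic, ← Measure.restrict_restrict measurableSet_Ioi,
        ← lintegral_indicator measurableSet_Ioi]
      rfl
    simp only [this]
    refine Measurable.lintegral_prod_right' (f := fun q : (ℝ≥0 × Ω) × ℝ≥0 =>
      if q.1.1 < q.2 then ENNReal.ofReal (ℓ q.2 q.1.2) else 0) ?_
    refine Measurable.ite (measurableSet_lt (by fun_prop) (by fun_prop)) ?_ measurable_const
    exact hm.comp (measurable_snd.prodMk (measurable_snd.comp measurable_fst))
  have hE₂ : ∫⁻ ω, Λ ω ^ 2 ∂P = 2 * I₂ := by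
    simp only [Λ, lintegral_sq_eq_two_mul (hmω _)]
    rw [lintegral_const_mul, lintegral_lintegral_swap]
    · exact (hmtail.comp measurable_swap).aemeasurable
    · exact hmtail.lintegral_prod_left'
  have hmN2 : Measurable fun p : ℝ≥0 × Ω => ENNReal.ofReal (ℓ p.1 p.2) * (N t p.2 : ℝ≥0∞) :=
    hm.mul ((hmN t).comp measurable_snd)
  have hE₁₂ : ∫⁻ ω, N t ω * Λ ω ∂P = I₁ + I₂ := by
    have h1 : ∀ ω, N t ω * Λ ω = ∫⁻ r in Icc 0 t, ENNReal.ofReal (ℓ r ω) * N t ω ∂leb := fun ω => by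
      rw [lintegral_mul_const _ (hmω ω), mul_comm]
    have h2 : Measurable (Function.uncurry fun ω r => ENNReal.ofReal (ℓ r ω) * (N t ω : ℝ≥0∞)) :=
      hmN2.comp measurable_swap
    rw [lintegral_congr h1, lintegral_lintegral_swap h2.aemeasurable,
      setLIntegral_congr_fun measurableSet_Icc fun r hr => h.lintegral_intensity_mul hr.2,
      lintegral_add_right]
    exact hmtail.lintegral_prod_right'
  have hmNℓ : Measurable fun p : Ω × ℝ≥0 => ENNReal.ofReal (ℓ p.2 p.1) * (N p.2 p.1 : ℝ≥0∞) :=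
    (hm.comp measurable_swap).mul ((measurable_from_nat.comp (measurable_of_continuousWithinAt_Ici
      (fun t => (h.adapted t).mono (𝓕.le t) le_rfl) h.counting.rightCts)).comp measurable_swap)
  have hE₁ : ∫⁻ ω, (N t ω : ℝ≥0∞) ^ 2 ∂P ≤ 2 * I₁ + ∫⁻ ω, Λ ω ∂P := by
    refine (h.lintegral_sq_le t).trans (le_of_eq ?_)
    have h1 : ∀ ω, ∫⁻ s in Icc 0 t, (2 * (N s ω : ℝ≥0∞) + 1) * ENNReal.ofReal (ℓ s ω) ∂leb
        = 2 * (∫⁻ s in Icc 0 t, ENNReal.ofReal (ℓ s ω) * N s ω ∂leb) + Λ ω := fun ω => by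
      have h2 : Measurable fun s => ENNReal.ofReal (ℓ s ω) * (N s ω : ℝ≥0∞) :=
        hmNℓ.comp measurable_prodMk_left
      rw [← lintegral_const_mul _ h2, ← lintegral_add_right _ (hmω ω)]
      refine lintegral_congr fun s => ?_
      ring
    rw [lintegral_congr h1, lintegral_add_right _ hmΛ, lintegral_const_mul,
      lintegral_lintegral_swap hmNℓ.aemeasurable]
    exact hmNℓ.lintegral_prod_right'
  have hsum : (∫⁻ ω, ENNReal.ofReal (((N t ω : ℝ) - ∫ s in Icc 0 t, ℓ s ω ∂leb) ^ 2) ∂P)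
      + 2 * (I₁ + I₂) ≤ ENNReal.ofReal (κ * t) + 2 * (I₁ + I₂) := by
    have hmNΛ : Measurable fun ω => N t ω * Λ ω := (hmN t).mul hmΛ
    rw [← hE₁₂, ← lintegral_const_mul _ hmNΛ, ← lintegral_add_right _ (hmNΛ.const_mul 2),
      lintegral_congr hpt, lintegral_add_right _ (hmΛ.pow_const 2), hE₂,
      lintegral_const_mul _ hmNΛ, hE₁₂]
    refine (add_le_add_left hE₁ _).trans ?_
    have hΛint : ∫⁻ ω, Λ ω ∂P ≤ ENNReal.ofReal (κ * t) :=
      (lintegral_mono hΛle).trans (by simp)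
    calc _ = (∫⁻ ω, Λ ω ∂P) + 2 * (I₁ + I₂) := by ring
      _ ≤ _ := by gcongr
  -- Cancelling the cross term in `ℝ≥0∞` requires it to be finite; this is what the bound `N ≤ n` is
  -- for.
  refine (ENNReal.add_le_add_iff_right ?_).1 hsum
  refine ENNReal.mul_ne_top (by simp) ?_
  rw [← hE₁₂]
  refine ne_top_of_le_ne_top (b := (n : ℝ≥0∞) * ENNReal.ofReal (κ * t)) (by finiteness) ?_
  refine (lintegral_mono fun ω => mul_le_mul' (Nat.cast_le.2 (hn t ω)) (hΛle ω)).trans ?_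
  simp

theorem HasStochasticIntensity.measure_le_abs_sub [IsProbabilityMeasure P]
    (h : HasStochasticIntensity P 𝓕 N ℓ) {n : ℕ} (hn : ∀ t ω, N t ω ≤ n) {κ : ℝ}
    (hκ : ∀ t ω, ℓ t ω ≤ κ) (t : ℝ≥0) {c : ℝ} (hc : 0 < c) :
    P {ω | c ≤ |(N t ω : ℝ) - ∫ s in Icc 0 t, ℓ s ω ∂leb|} ≤ ENNReal.ofReal (κ * t / c ^ 2) := by
  have hm : Measurable fun ω =>
      ENNReal.ofReal (((N t ω : ℝ) - ∫ s in Icc 0 t, ℓ s ω ∂leb) ^ 2) := by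
    refine Measurable.ennreal_ofReal (Measurable.pow_const (Measurable.sub ?_ ?_) 2)
    · exact measurable_from_nat.comp ((h.adapted t).mono (𝓕.le t) le_rfl)
    · exact (StronglyMeasurable.integral_prod_left'
        h.progressive.measurable_uncurry.stronglyMeasurable).measurable
  have h1 := mul_meas_ge_le_lintegral (μ := P) hm (ENNReal.ofReal (c ^ 2))
  have h2 := h1.trans (h.lintegral_sub_sq_le hn hκ t)
  rw [ENNReal.ofReal_div_of_pos (by positivity),
    ENNReal.le_div_iff_mul_le (Or.inl (by simpa using hc.ne')) (Or.inl ENNReal.ofReal_ne_top),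
    mul_comm]
  refine le_trans (mul_le_mul_right (measure_mono fun ω hω => ?_) _) h2
  refine ENNReal.ofReal_le_ofReal ?_
  rw [← sq_abs ((N t ω : ℝ) - _)]
  exact pow_le_pow_left₀ hc.le hω 2

/-- A nondecreasing path stays close to a Lipschitz one if it does so on a grid. -/
theorem abs_sub_le_of_grid {f g : ℝ≥0 → ℝ} {T : ℝ≥0} {m : ℕ} (hm : 0 < m) {c κ : ℝ}
    (hf : Monotone f) (hg : Monotone g) (hκ : ∀ a b, a ≤ b → g b - g a ≤ κ * ((b : ℝ) - a))
    (hc : ∀ j ≤ m, |f (j * (T / m)) - g (j * (T / m))| ≤ c) {t : ℝ≥0} (ht : t ≤ T) :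
    |f t - g t| ≤ c + κ * (T / m) := by
  set h : ℝ≥0 := T / m with hh
  have hex : ∃ j : ℕ, t ≤ j * h := ⟨m, by rwa [hh, mul_div_cancel₀ _ (by positivity)]⟩
  have hstep : ∀ a : ℝ≥0, g (a + h) - g a ≤ κ * (T / m) := fun a => by
    have := hκ a (a + h) le_self_add
    rwa [NNReal.coe_add, add_sub_cancel_left, hh, NNReal.coe_div, NNReal.coe_natCast] at this
  classical
  -- `j` is the first grid index at or beyond `t`. If `j = 0` then `t = 0`; otherwise `f t` and `g
  -- t` lie between their values at two neighbouring grid points, where `g` varies by at most `κ *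
  -- (T / m)`.
  obtain ⟨j, hj, hmin⟩ : ∃ j : ℕ, t ≤ j * h ∧ ∀ i < j, i * h < t :=
    ⟨Nat.find hex, Nat.find_spec hex, fun i hi => not_le.1 (Nat.find_min hex hi)⟩
  have hjm : j ≤ m := by
    by_contra hlt
    have := hmin m (not_le.1 hlt)
    rw [hh, mul_div_cancel₀ _ (by positivity)] at this
    exact this.not_ge ht
  rcases j with _ | i
  · have ht0 : t = ((0 : ℕ) : ℝ≥0) * h := le_antisymm hj (by simp)
    have h1 := hc 0 hjm
    rw [← ht0] at h1
    have h2 := hstep 0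
    have h3 := hg (zero_le : 0 ≤ 0 + h)
    linarith
  · have h1 := hmin i (Nat.lt_succ_self i)
    have ca := abs_le.1 (hc i (Nat.le_of_succ_le hjm))
    have cb := abs_le.1 (hc (i + 1) hjm)
    have hst := hstep (i * h)
    have hb : ((i + 1 : ℕ) : ℝ≥0) * h = i * h + h := by push_cast; ring
    rw [hb] at hj cb
    have := hf h1.le
    have := hf hj
    have := hg h1.le
    have := hg hj
    exact abs_le.2 ⟨by linarith, by linarith⟩

end SecondMoment

/-! ### Uniform laws of large numbers -/

theorem markCount_cast {Ω : Type*} {ξ : ℕ → Ω → ℝ} {S : Set ℝ} (k : ℕ) (ω : Ω) :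
    (markCount ξ S k ω : ℝ) = ∑ i ∈ Finset.range k, S.indicator 1 (ξ i ω) := by
  classical
  rw [markCount, Finset.card_filter, Nat.cast_sum]
  refine Finset.sum_congr rfl fun i _ => ?_
  by_cases h : ξ i ω ∈ S <;> simp [h]

theorem markCount_Iio_add_Ici {Ω : Type*} (ξ : ℕ → Ω → ℝ) (b : ℝ) (k : ℕ) (ω : Ω) :
    markCount ξ (Iio b) k ω + markCount ξ (Ici b) k ω = k := by
  classical
  have h : ∀ i, ξ i ω ∈ Ici b ↔ ¬ ξ i ω ∈ Iio b := fun i => by simp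
  simp only [markCount, h]
  convert Finset.card_filter_add_card_filter_not (s := Finset.range k) (fun i => ξ i ω ∈ Iio b)
  simp

section LLN
variable {Ω : Type*} [mΩ : MeasurableSpace Ω] {P : Measure Ω} [IsProbabilityMeasure P]

/-- Uniform law of large numbers for counting processes bounded by `n` whose intensities are
bounded by `K * n`. -/
theorem tendsto_measure_compensated {𝓕 : ℕ → Filtration ℝ≥0 mΩ} {N : ℕ → ℝ≥0 → Ω → ℕ}
    {ℓ : ℕ → ℝ≥0 → Ω → ℝ} {K : ℝ} (hK : 0 ≤ K)
    (h : ∀ n, 1 ≤ n → HasStochasticIntensity P (𝓕 n) (N n) (ℓ n))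
    (hN : ∀ n, 1 ≤ n → ∀ t ω, N n t ω ≤ n) (hℓ : ∀ n, 1 ≤ n → ∀ t ω, ℓ n t ω ≤ K * n)
    (T : ℝ≥0) {ε : ℝ} (hε : 0 < ε) :
    Tendsto (fun n : ℕ => P {ω | ∃ t ≤ T,
      ε * n < |(N n t ω : ℝ) - ∫ s in Icc 0 t, ℓ n s ω ∂leb|}) atTop (𝓝 0) := by
  -- The mesh makes the compensator vary by at most `ε * n / 2` per cell, leaving `ε * n / 2` for
  -- the grid points. Since `m` does not depend on `n`, a union bound over `m + 1` Chebyshev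
  -- estimates of order `1 / n` is enough.
  obtain ⟨m, hm⟩ := exists_nat_gt (2 * (K * T) / ε)
  have hm0 : 0 < m := by
    have : (0 : ℝ) < m := lt_of_le_of_lt (by positivity) hm
    exact_mod_cast this
  have hm' : K * (T / m) ≤ ε / 2 := by
    rw [div_lt_iff₀ hε] at hm
    rw [mul_div_assoc', div_le_iff₀ (by exact_mod_cast hm0)]
    linarith
  have hbound : ∀ n : ℕ, 1 ≤ n → P {ω | ∃ t ≤ T,
      ε * n < |(N n t ω : ℝ) - ∫ s in Icc 0 t, ℓ n s ω ∂leb|}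
        ≤ (m + 1 : ℕ) * ENNReal.ofReal (4 * K * T / ε ^ 2 / n) := by
    intro n hn
    have hn0 : (0 : ℝ) < n := by exact_mod_cast hn
    set c : ℝ := ε * n / 2 with hc
    have hc0 : 0 < c := by positivity
    have hsub : {ω | ∃ t ≤ T, ε * n < |(N n t ω : ℝ) - ∫ s in Icc 0 t, ℓ n s ω ∂leb|}
        ⊆ ⋃ j ∈ Finset.range (m + 1), {ω | c ≤ |(N n (j * (T / m)) ω : ℝ)
          - ∫ s in Icc 0 (j * (T / m)), ℓ n s ω ∂leb|} := by
      rintro ω ⟨t, ht, hlt⟩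
      by_contra hnot
      simp only [mem_iUnion, mem_ofPred_eq, not_exists, not_le, Finset.mem_range] at hnot
      have hmℓ : Measurable fun s => ℓ n s ω :=
        (h n hn).progressive.measurable_uncurry.comp measurable_prodMk_right
      have hb : ∀ s, |ℓ n s ω| ≤ K * n := fun s => by
        rw [abs_of_nonneg ((h n hn).nonneg s ω)]
        exact hℓ n hn s ω
      have hinc : ∀ a b : ℝ≥0, a ≤ b → (∫ s in Icc 0 b, ℓ n s ω ∂leb)
          - ∫ s in Icc 0 a, ℓ n s ω ∂leb = ∫ s in Ioc a b, ℓ n s ω ∂leb := fun a b hab => by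
        rw [integral_leb_add_Ioc hab (integrableOn_leb_of_bounded hmℓ fun s _ => hb s),
          add_sub_cancel_left]
      refine hlt.not_ge ((abs_sub_le_of_grid (f := fun t => (N n t ω : ℝ))
        (g := fun t => ∫ s in Icc 0 t, ℓ n s ω ∂leb) hm0 (κ := K * n) (c := c)
        (fun a b hab => Nat.cast_le.2 ((h n hn).counting.mono ω hab)) (fun a b hab => ?_)
        (fun a b hab => ?_) (fun j hj => (hnot j (by omega)).le) ht).trans ?_)
      · have := hinc a b hab
        have h2 : 0 ≤ ∫ s in Ioc a b, ℓ n s ω ∂leb := integral_nonneg fun s => (h n hn).nonneg s ω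
        change (∫ s in Icc 0 a, ℓ n s ω ∂leb) ≤ ∫ s in Icc 0 b, ℓ n s ω ∂leb
        linarith
      · rw [hinc a b hab]
        exact (le_abs_self _).trans (abs_integral_Ioc_leb_le hab fun r _ => hb r)
      · rw [hc]
        nlinarith
    refine (measure_mono hsub).trans ((measure_biUnion_finset_le _ _).trans ?_)
    refine (Finset.sum_le_card_nsmul _ _ (ENNReal.ofReal (4 * K * T / ε ^ 2 / n))
      fun j hj => ?_).trans (le_of_eq ?_)
    · refine ((h n hn).measure_le_abs_sub (hN n hn) (hℓ n hn) _ hc0).trans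
        (ENNReal.ofReal_le_ofReal ?_)
      have hj' : (j : ℝ) ≤ m := by
        have := Finset.mem_range.1 hj
        exact_mod_cast (by omega : j ≤ m)
      have hjT : ((j * (T / m) : ℝ≥0) : ℝ) ≤ T := by
        push_cast
        rw [mul_div_assoc', div_le_iff₀ (by exact_mod_cast hm0), mul_comm]
        exact mul_le_mul_of_nonneg_left hj' T.coe_nonneg
      calc K * n * ((j * (T / m) : ℝ≥0) : ℝ) / c ^ 2 ≤ K * n * T / c ^ 2 := by gcongr
        _ = 4 * K * T / ε ^ 2 / n := by
          rw [hc]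
          field_simp
          ring
    · rw [Finset.card_range, nsmul_eq_mul]
  have hlim : Tendsto (fun n : ℕ => ((m + 1 : ℕ) : ℝ≥0∞)
      * ENNReal.ofReal (4 * K * T / ε ^ 2 / n)) atTop (𝓝 0) := by
    have h1 := ENNReal.tendsto_ofReal (tendsto_const_div_atTop_nhds_zero_nat (4 * K * T / ε ^ 2))
    rw [ENNReal.ofReal_zero] at h1
    have h2 := ENNReal.Tendsto.const_mul (a := ((m + 1 : ℕ) : ℝ≥0∞)) h1
      (Or.inr (ENNReal.natCast_ne_top _))
    rwa [mul_zero] at h2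
  refine tendsto_of_tendsto_of_tendsto_of_le_of_le' tendsto_const_nhds hlim
    (Eventually.of_forall fun _ => zero_le) ?_
  filter_upwards [eventually_ge_atTop 1] with n hn using hbound n hn

/-- Hoeffding's inequality for both tails: an indicator takes values in `[0, 1]`, so once centred it
is sub-Gaussian with variance proxy `1 / 4`. -/
theorem IsIIDUniform.measureReal_markCount_le {ξ : ℕ → Ω → ℝ} (hξ : IsIIDUniform P ξ) {b : ℝ}
    (hb : b ∈ Icc (0 : ℝ) 1) {c : ℝ} (hc : 0 < c) (k : ℕ) :
    P.real {ω | c ≤ |(markCount ξ (Ici b) k ω : ℝ) - (1 - b) * k|}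
      ≤ 2 * Real.exp (-c ^ 2 / (2 * k * (1 / 4))) := by
  have hms : Measurable ((Ici b).indicator (1 : ℝ → ℝ)) :=
    measurable_one.indicator measurableSet_Ici
  have hae : ∀ i, AEMeasurable (ξ i) P := fun i =>
    (hξ.2 i).aemeasurable (by simp) (by simp)
  let X (i : ℕ) (ω : Ω) : ℝ := (Ici b).indicator 1 (ξ i ω)
  have hX : ∀ i, AEMeasurable (X i) P := fun i => hms.comp_aemeasurable (hae i)
  have hmean : ∀ i, P[X i] = 1 - b := fun i => by
    have h1 : P[X i] = ∫ x, (Ici b).indicator 1 x ∂(P.map (ξ i)) :=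
      (integral_map (hae i) hms.aestronglyMeasurable).symm
    rw [h1, integral_indicator_one measurableSet_Ici, hξ.2 i, measureReal_def,
      ProbabilityTheory.cond_apply measurableSet_Icc]
    have : Icc (0 : ℝ) 1 ∩ Ici b = Icc b 1 := by
      ext x
      simp only [mem_inter_iff, mem_Icc, mem_Ici]
      exact ⟨fun h => ⟨h.2, h.1.2⟩, fun h => ⟨⟨hb.1.trans h.1, h.2⟩, h.1⟩⟩
    rw [this, Real.volume_Icc, Real.volume_Icc]
    simp [hb.2]
  have hsub : ∀ i, HasSubgaussianMGF (fun ω => X i ω - (1 - b)) (1 / 4) P := fun i => by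
    have h1 := hasSubgaussianMGF_of_mem_Icc (a := 0) (b := 1) (hX i) (ae_of_all _ fun ω => by
      simp only [X, indicator]
      split_ifs <;> simp)
    rw [hmean] at h1
    convert h1 using 1
    rw [← NNReal.coe_inj]
    norm_num
  have hind : iIndepFun (fun i ω => X i ω - (1 - b)) P :=
    hξ.1.comp (fun _ x => (Ici b).indicator 1 x - (1 - b)) fun _ => hms.sub_const _
  have hind' : iIndepFun (fun i => -fun ω => X i ω - (1 - b)) P :=
    hξ.1.comp (fun _ x => -((Ici b).indicator 1 x - (1 - b))) fun _ => (hms.sub_const _).neg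
  have hup := HasSubgaussianMGF.measure_sum_range_ge_le_of_iIndepFun hind (n := k)
    (fun i _ => hsub i) hc.le
  have hlo := HasSubgaussianMGF.measure_sum_range_ge_le_of_iIndepFun hind' (n := k)
    (fun i _ => (hsub i).neg) hc.le
  have hval : ∀ ω, (markCount ξ (Ici b) k ω : ℝ) - (1 - b) * k
      = ∑ i ∈ Finset.range k, (X i ω - (1 - b)) := fun ω => by
    rw [markCount_cast, Finset.sum_sub_distrib, Finset.sum_const, Finset.card_range, nsmul_eq_mul,
      mul_comm (k : ℝ)]
  have hcover : {ω | c ≤ |(markCount ξ (Ici b) k ω : ℝ) - (1 - b) * k|}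
      ⊆ {ω | c ≤ ∑ i ∈ Finset.range k, (X i ω - (1 - b))}
        ∪ {ω | c ≤ ∑ i ∈ Finset.range k, (-fun ω => X i ω - (1 - b)) ω} := by
    intro ω hω
    rw [mem_ofPred_eq, hval, le_abs] at hω
    refine hω.imp id fun h => ?_
    simpa only [mem_ofPred_eq, Pi.neg_apply, Finset.sum_neg_distrib] using h
  refine (measureReal_mono hcover).trans ((measureReal_union_le _ _).trans ?_)
  rw [two_mul]
  push_cast at hup hlo
  exact add_le_add hup hlo

/-- Uniform law of large numbers for marks. -/
theorem tendsto_measure_markCount {ξ : ℕ → ℕ → Ω → ℝ}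
    (hξ : ∀ n, 1 ≤ n → IsIIDUniform P (ξ n)) {b : ℝ} (hb : b ∈ Icc (0 : ℝ) 1) {ε : ℝ}
    (hε : 0 < ε) :
    Tendsto (fun n : ℕ => P {ω | ∃ k ≤ n,
      ε * n < |(markCount (ξ n) (Ici b) k ω : ℝ) - (1 - b) * k|}) atTop (𝓝 0) := by
  have hbound : ∀ n : ℕ, 1 ≤ n → P {ω | ∃ k ≤ n,
      ε * n < |(markCount (ξ n) (Ici b) k ω : ℝ) - (1 - b) * k|}
        ≤ ENNReal.ofReal (2 * (n * Real.exp (-2 * ε ^ 2) ^ n)) := by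
    intro n hn
    have hn0 : (0 : ℝ) < n := by exact_mod_cast hn
    have hsub : {ω | ∃ k ≤ n, ε * n < |(markCount (ξ n) (Ici b) k ω : ℝ) - (1 - b) * k|}
        ⊆ ⋃ k ∈ Finset.Icc 1 n,
          {ω | ε * n ≤ |(markCount (ξ n) (Ici b) k ω : ℝ) - (1 - b) * k|} := by
      rintro ω ⟨k, hk, hlt⟩
      -- At `k = 0` the deviation is zero. For `1 ≤ k ≤ n` the exponent `-2 (ε n)² / k` is at most
      -- `-2 ε² n`, so the union bound is `2 n exp (-2 ε² n)`.
      have hk0 : k ≠ 0 := by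
        rintro rfl
        refine hlt.not_ge ?_
        simp only [markCount, Finset.range_zero, Finset.filter_empty, Finset.card_empty]
        norm_num
        positivity
      exact mem_biUnion (Finset.mem_Icc.2 ⟨Nat.one_le_iff_ne_zero.2 hk0, hk⟩) hlt.le
    refine (measure_mono hsub).trans ((measure_biUnion_finset_le _ _).trans ?_)
    refine (Finset.sum_le_card_nsmul _ _ (ENNReal.ofReal (2 * Real.exp (-2 * ε ^ 2) ^ n))
      fun k hk => ?_).trans (le_of_eq ?_)
    · rw [← ofReal_measureReal]
      refine ENNReal.ofReal_le_ofReal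
        (((hξ n hn).measureReal_markCount_le hb (by positivity) k).trans ?_)
      obtain ⟨hk1, hkn⟩ := Finset.mem_Icc.1 hk
      have hk0 : (0 : ℝ) < k := by exact_mod_cast hk1
      have hkn' : (k : ℝ) ≤ n := by exact_mod_cast hkn
      rw [← Real.exp_nat_mul]
      gcongr
      rw [div_le_iff₀ (by positivity)]
      nlinarith [mul_le_mul_of_nonneg_left hkn' (by positivity : 0 ≤ ε ^ 2 * n)]
    · rw [Nat.card_Icc, nsmul_eq_mul, Nat.add_sub_cancel, ← ENNReal.ofReal_natCast,
        ← ENNReal.ofReal_mul hn0.le]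
      congr 1
      ring
  have hlim : Tendsto (fun n : ℕ => ENNReal.ofReal (2 * (n * Real.exp (-2 * ε ^ 2) ^ n)))
      atTop (𝓝 0) := by
    have hr : Real.exp (-2 * ε ^ 2) < 1 := by
      rw [Real.exp_lt_one_iff]
      nlinarith [sq_pos_of_pos hε]
    have h1 := ENNReal.tendsto_ofReal
      ((tendsto_self_mul_const_pow_of_lt_one (Real.exp_pos _).le hr).const_mul 2)
    rwa [mul_zero, ENNReal.ofReal_zero] at h1
  refine tendsto_of_tendsto_of_tendsto_of_le_of_le' tendsto_const_nhds hlim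
    (Eventually.of_forall fun _ => zero_le) ?_
  filter_upwards [eventually_ge_atTop 1] with n hn using hbound n hn

end LLN

/-! ### The rumor model -/

section Model
variable {Ω : Type*} [mΩ : MeasurableSpace Ω] {P : Measure Ω} {n : ℕ}
  {lam th gam : ℝ≥0 → ℝ≥0} {δ β : ℝ} {R : RumorProcess Ω}

/-- Adding the three state equations cancels `B`, `C` and the marks, so `A` is the increase of `U +
Y + Z`; `B` and `C` are summands of `Z`. -/
theorem IsLMRModel.counts_le (h : IsLMRModel P n lam th gam δ β R) (t : ℝ≥0) (ω : Ω) :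
    R.A t ω ≤ n ∧ R.B t ω ≤ n ∧ R.C t ω ≤ n := by
  have h1 := h.closed t ω
  have h2 := h.eq_U t ω
  have h3 := h.eq_Y t ω
  have h4 := h.eq_Z t ω
  have h5 := markCount_Iio_add_Ici R.markA δ (R.A t ω) ω
  omega

theorem IsLMRModel.intensity_le (h : IsLMRModel P n lam th gam δ β R) {K : ℝ}
    (hlamK : ∀ t, (lam t : ℝ) ≤ K) (hthK : ∀ t, (th t : ℝ) ≤ K) (hgamK : ∀ t, (gam t : ℝ) ≤ K)
    (t : ℝ≥0) (ω : Ω) :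
    (lam t : ℝ) * (R.X t ω : ℝ) * ((R.Y t ω : ℝ) / n) ≤ K * n ∧
    (th t : ℝ) * ((R.Y t ω : ℝ) - 1) * ((R.Y t ω : ℝ) / n) ≤ K * n ∧
    (gam t : ℝ) * ((R.U t ω : ℝ) + (R.Z t ω : ℝ)) * ((R.Y t ω : ℝ) / n) ≤ K * n := by
  have h1 : (R.X t ω : ℝ) + R.U t ω + R.Y t ω + R.Z t ω = n := by exact_mod_cast h.closed t ω
  have hX : (0 : ℝ) ≤ R.X t ω := Nat.cast_nonneg _
  have hU : (0 : ℝ) ≤ R.U t ω := Nat.cast_nonneg _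
  have hY : (0 : ℝ) ≤ R.Y t ω := Nat.cast_nonneg _
  have hZ : (0 : ℝ) ≤ R.Z t ω := Nat.cast_nonneg _
  have hK : 0 ≤ K := (NNReal.coe_nonneg _).trans (hlamK 0)
  have hn : (0 : ℝ) ≤ n := Nat.cast_nonneg _
  have hr0 : 0 ≤ (R.Y t ω : ℝ) / n := by positivity
  have hr1 : (R.Y t ω : ℝ) / n ≤ 1 := div_le_one_of_le₀ (by linarith) hn
  have key : ∀ {a v : ℝ}, 0 ≤ a → a ≤ K → v ≤ n → a * v * ((R.Y t ω : ℝ) / n) ≤ K * n := by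
    intro a v ha haK hv
    calc a * v * ((R.Y t ω : ℝ) / n) ≤ a * n * ((R.Y t ω : ℝ) / n) := by gcongr
      _ ≤ K * n * 1 := by gcongr
      _ = K * n := mul_one _
  exact ⟨key (NNReal.coe_nonneg _) (hlamK t) (by linarith),
    key (NNReal.coe_nonneg _) (hthK t) (by linarith),
    key (NNReal.coe_nonneg _) (hgamK t) (by linarith)⟩

/-- On the event where the compensated counts and the marks are all within `η n` of zero and of
their means, the scaled paths solve the fluid equations up to `9 η`. -/
theorem IsLMRModel.isApproxFluid (h : IsLMRModel P n lam th gam δ β R) (hn : 1 ≤ n) {K : ℝ}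
    (hth : Measurable th) (hthK : ∀ t, (th t : ℝ) ≤ K)
    (hδ : δ ∈ Icc (0 : ℝ) 1) (hβ : β ∈ Icc (0 : ℝ) 1) {u₀ y₀ z₀ η : ℝ} {T : ℝ≥0} (hη : 0 ≤ η)
    (hKη : K * T ≤ η * n) {ω : Ω}
    (hu : |(R.U 0 ω : ℝ) / n - u₀| ≤ η) (hy : |(R.Y 0 ω : ℝ) / n - y₀| ≤ η)
    (hz : |(R.Z 0 ω : ℝ) / n - z₀| ≤ η)
    (hA : ∀ t ≤ T, |(R.A t ω : ℝ) - ∫ s in Icc 0 t,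
      (lam s : ℝ) * (R.X s ω : ℝ) * ((R.Y s ω : ℝ) / n) ∂leb| ≤ η * n)
    (hB : ∀ t ≤ T, |(R.B t ω : ℝ) - ∫ s in Icc 0 t,
      (th s : ℝ) * ((R.Y s ω : ℝ) - 1) * ((R.Y s ω : ℝ) / n) ∂leb| ≤ η * n)
    (hC : ∀ t ≤ T, |(R.C t ω : ℝ) - ∫ s in Icc 0 t,
      (gam s : ℝ) * ((R.U s ω : ℝ) + (R.Z s ω : ℝ)) * ((R.Y s ω : ℝ) / n) ∂leb| ≤ η * n)
    (hmA : ∀ k ≤ n, |(markCount R.markA (Ici δ) k ω : ℝ) - (1 - δ) * k| ≤ η * n)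
    (hmB : ∀ k ≤ n, |(markCount R.markB (Ici β) k ω : ℝ) - (1 - β) * k| ≤ η * n) :
    IsApproxFluid lam th gam δ β u₀ y₀ z₀ T 1 (9 * η) (fun t => (R.X t ω : ℝ) / n)
      (fun t => (R.U t ω : ℝ) / n) (fun t => (R.Y t ω : ℝ) / n) (fun t => (R.Z t ω : ℝ) / n) := by
  have hn0 : (0 : ℝ) < n := by exact_mod_cast hn
  have hn1 : (n : ℝ) ≠ 0 := hn0.ne'
  have hK : 0 ≤ K := (NNReal.coe_nonneg _).trans (hthK 0)
  have mth : Measurable fun s => (th s : ℝ) := measurable_coe_nnreal_real.comp hth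
  have eU : ∀ t, (R.U t ω : ℝ) = R.U 0 ω + markCount R.markA (Ici δ) (R.A t ω) ω := fun t => by
    exact_mod_cast h.eq_U t ω
  have eZ : ∀ t, (R.Z t ω : ℝ) = R.Z 0 ω + R.B t ω + markCount R.markB (Ici β) (R.B t ω) ω
      + R.C t ω := fun t => by exact_mod_cast h.eq_Z t ω
  have eY : ∀ t, (R.Y t ω : ℝ) = R.Y 0 ω + (R.A t ω - markCount R.markA (Ici δ) (R.A t ω) ω)
      - R.B t ω - markCount R.markB (Ici β) (R.B t ω) ω - R.C t ω := fun t => by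
    have h1 : (R.Y t ω : ℝ) = R.Y 0 ω + markCount R.markA (Iio δ) (R.A t ω) ω
        - R.B t ω - markCount R.markB (Ici β) (R.B t ω) ω - R.C t ω := by
      exact_mod_cast h.eq_Y t ω
    have h2 : (markCount R.markA (Iio δ) (R.A t ω) ω : ℝ)
        + markCount R.markA (Ici δ) (R.A t ω) ω = R.A t ω := by
      exact_mod_cast markCount_Iio_add_Ici R.markA δ (R.A t ω) ω
    rw [h1, ← h2]
    ring
  have etot : ∀ t, (R.X t ω : ℝ) + R.U t ω + R.Y t ω + R.Z t ω = n := fun t => by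
    exact_mod_cast h.closed t ω
  have eX : ∀ t, (R.X t ω : ℝ) = n - R.U t ω - R.Y t ω - R.Z t ω := fun t => by
    linarith [etot t]
  have mA : Measurable fun t => R.A t ω := (h.intensity_A.counting.mono ω).measurable
  have mB : Measurable fun t => R.B t ω := (h.intensity_B.counting.mono ω).measurable
  have mC : Measurable fun t => R.C t ω := (h.intensity_C.counting.mono ω).measurable
  have nat : ∀ {f : ℝ≥0 → ℕ} (g : ℕ → ℝ), Measurable f → Measurable fun t => g (f t) :=
    fun g hf => measurable_from_nat.comp hf
  have mA' := nat (fun k => (k : ℝ)) mA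
  have mB' := nat (fun k => (k : ℝ)) mB
  have mC' := nat (fun k => (k : ℝ)) mC
  have mmA := nat (fun k => (markCount R.markA (Ici δ) k ω : ℝ)) mA
  have mmB := nat (fun k => (markCount R.markB (Ici β) k ω : ℝ)) mB
  have mU : Measurable fun t => (R.U t ω : ℝ) := by
    rw [funext eU]
    fun_prop
  have mZ : Measurable fun t => (R.Z t ω : ℝ) := by
    rw [funext eZ]
    fun_prop
  have mY : Measurable fun t => (R.Y t ω : ℝ) := by
    rw [funext eY]
    fun_prop
  have mX : Measurable fun t => (R.X t ω : ℝ) := by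
    rw [funext eX]
    fun_prop
  have bnd : ∀ {k : ℕ}, k ≤ n → |(k : ℝ) / n| ≤ 1 := fun hk => by
    rw [abs_of_nonneg (by positivity)]
    exact div_le_one_of_le₀ (by exact_mod_cast hk) hn0.le
  have scale : ∀ {a b c : ℝ}, c = b / n → |a - b| ≤ η * n → |a / n - c| ≤ η := by
    intro a b c hc hab
    rw [hc, ← sub_div, abs_div, abs_of_pos hn0, div_le_iff₀ hn0]
    exact hab
  have fA : ∀ t ≤ T, |(R.A t ω : ℝ) / n - fluidA lam (fun t => (R.X t ω : ℝ) / n)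
      (fun t => (R.Y t ω : ℝ) / n) t| ≤ η := fun t ht => by
    refine scale ?_ (hA t ht)
    rw [fluidA, ← integral_div]
    congr 1 with s
    ring
  have fC : ∀ t ≤ T, |(R.C t ω : ℝ) / n - fluidC gam (fun t => (R.U t ω : ℝ) / n)
      (fun t => (R.Y t ω : ℝ) / n) (fun t => (R.Z t ω : ℝ) / n) t| ≤ η := fun t ht => by
    refine scale ?_ (hC t ht)
    rw [fluidC, ← integral_div]
    congr 1 with s
    ring
  -- A spreader does not meet itself, so the scaled intensity differs from the fluid rate by `th *
  -- (Y / n) / n`. Its integral is at most `K * T / n ≤ η`, which accounts for the second `η`.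
  have fB : ∀ t ≤ T, |(R.B t ω : ℝ) / n - fluidB th (fun t => (R.Y t ω : ℝ) / n) t| ≤ 2 * η := by
    intro t ht
    have hYle : ∀ s, R.Y s ω ≤ n := fun s => by have := h.closed s ω; omega
    have habs : ∀ s, |(th s : ℝ)| ≤ K := fun s => by
      rw [abs_of_nonneg (NNReal.coe_nonneg _)]
      exact hthK s
    have h1 : |(R.B t ω : ℝ) / n - (∫ s in Icc 0 t, ((th s : ℝ) * ((R.Y s ω : ℝ) / n) ^ 2
        - (th s : ℝ) * ((R.Y s ω : ℝ) / n) / n) ∂leb)| ≤ η := by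
      refine scale ?_ (hB t ht)
      rw [← integral_div]
      congr 1 with s
      field_simp
    have i1 : IntegrableOn (fun s => (th s : ℝ) * ((R.Y s ω : ℝ) / n) ^ 2) (Icc 0 t) leb := by
      refine integrableOn_leb_of_bounded (mth.mul ((mY.div_const _).pow_const 2)) (K := K * (1 * 1))
        fun s _ => ?_
      change |(th s : ℝ) * ((R.Y s ω : ℝ) / n) ^ 2| ≤ _
      rw [pow_two]
      exact abs_mul_le_of_le (habs s) (abs_mul_le_of_le (bnd (hYle s)) (bnd (hYle s)))
    have b2 : ∀ s, |(th s : ℝ) * ((R.Y s ω : ℝ) / n) / n| ≤ K * 1 / n := fun s => by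
      rw [abs_div, abs_of_pos hn0]
      exact div_le_div_of_nonneg_right (abs_mul_le_of_le (habs s) (bnd (hYle s))) hn0.le
    have i2 : IntegrableOn (fun s => (th s : ℝ) * ((R.Y s ω : ℝ) / n) / n) (Icc 0 t) leb :=
      integrableOn_leb_of_bounded ((mth.mul (mY.div_const _)).div_const _) fun s _ => b2 s
    have h2 := abs_integral_leb_le (t := t) fun s _ => b2 s
    have h3 : K * 1 / n * t ≤ η := by
      rw [mul_one, div_mul_eq_mul_div, div_le_iff₀ hn0]
      exact (mul_le_mul_of_nonneg_left (NNReal.coe_le_coe.2 ht) hK).trans hKη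
    rw [integral_sub i1 i2] at h1
    have h1' := abs_le.1 h1
    have h2' := abs_le.1 (h2.trans h3)
    rw [fluidB]
    exact abs_le.2 ⟨by linarith, by linarith⟩
  have gA : ∀ t, |(markCount R.markA (Ici δ) (R.A t ω) ω : ℝ) / n - (1 - δ) * (R.A t ω / n)| ≤ η :=
    fun t => scale (mul_div_assoc _ _ _).symm (hmA _ (h.counts_le t ω).1)
  have gB : ∀ t, |(markCount R.markB (Ici β) (R.B t ω) ω : ℝ) / n - (1 - β) * (R.B t ω / n)| ≤ η :=
    fun t => scale (mul_div_assoc _ _ _).symm (hmB _ (h.counts_le t ω).2.1)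
  have b1 : |1 - δ| ≤ 1 := abs_le.2 ⟨by linarith [hδ.2], by linarith [hδ.1]⟩
  have b2 : |δ| ≤ 1 := abs_le.2 ⟨by linarith [hδ.1], hδ.2⟩
  have b3 : |2 - β| ≤ 2 := abs_le.2 ⟨by linarith [hβ.2], by linarith [hβ.1]⟩
  have hu' := abs_le.1 hu
  have hy' := abs_le.1 hy
  have hz' := abs_le.1 hz
  refine ⟨mX.div_const _, mU.div_const _, mY.div_const _, mZ.div_const _,
    fun t _ => bnd ?_, fun t _ => bnd ?_, fun t _ => bnd ?_, fun t _ => bnd ?_,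
    fun t ht => ?_, fun t ht => ?_, fun t ht => ?_, fun t ht => ?_⟩
  iterate 4
    have := h.closed t ω
    omega
  · have a1 := abs_le.1 (fA t ht)
    have e : (R.X t ω : ℝ) / n = 1 - R.U 0 ω / n - R.Y 0 ω / n - R.Z 0 ω / n - R.A t ω / n := by
      rw [eX, eU, eY, eZ]
      field_simp
      ring
    rw [e]
    exact abs_le.2 ⟨by linarith, by linarith⟩
  · have a1 := abs_le.1 (abs_mul_le_of_le b1 (fA t ht))
    have a2 := abs_le.1 (gA t)
    have e : (R.U t ω : ℝ) / n = R.U 0 ω / n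
        + (markCount R.markA (Ici δ) (R.A t ω) ω : ℝ) / n := by
      rw [eU, add_div]
    rw [e]
    exact abs_le.2 ⟨by linarith, by linarith⟩
  -- The largest error is that of the spreaders: `η` each from the initial value, the two mark
  -- counts, `A` and `C`, and `2 * (2 * η)` from `B`, in total `9 * η`.
  · have a1 := abs_le.1 (abs_mul_le_of_le b2 (fA t ht))
    have a2 := abs_le.1 (gA t)
    have a3 := abs_le.1 (abs_mul_le_of_le b3 (fB t ht))
    have a4 := abs_le.1 (gB t)
    have a5 := abs_le.1 (fC t ht)
    have e : (R.Y t ω : ℝ) / n = R.Y 0 ω / n + (R.A t ω / n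
        - (markCount R.markA (Ici δ) (R.A t ω) ω : ℝ) / n) - R.B t ω / n
        - (markCount R.markB (Ici β) (R.B t ω) ω : ℝ) / n - R.C t ω / n := by
      rw [eY]
      ring
    rw [e]
    exact abs_le.2 ⟨by linarith, by linarith⟩
  · have a3 := abs_le.1 (abs_mul_le_of_le b3 (fB t ht))
    have a4 := abs_le.1 (gB t)
    have a5 := abs_le.1 (fC t ht)
    have e : (R.Z t ω : ℝ) / n = R.Z 0 ω / n + R.B t ω / n
        + (markCount R.markB (Ici β) (R.B t ω) ω : ℝ) / n + R.C t ω / n := by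
      rw [eZ]
      ring
    rw [e]
    exact abs_le.2 ⟨by linarith, by linarith⟩

end Model

end

/-- Functional law of large numbers for the non-Markovian LMR rumor model. -/
theorem mainTheorem4 {Ω : Type*} [MeasurableSpace Ω] (P : Measure Ω) [IsProbabilityMeasure P]
    (lam th gam : ℝ≥0 → ℝ≥0)
    (hlam : Measurable lam) (hth : Measurable th) (hgam : Measurable gam)
    (hlam_bdd : ∃ K, ∀ t, lam t ≤ K) (hth_bdd : ∃ K, ∀ t, th t ≤ K)
    (hgam_bdd : ∃ K, ∀ t, gam t ≤ K)
    (δ θ₁ θ₂ β : ℝ) (hδ : δ ∈ Icc (0 : ℝ) 1) (hθ₁ : 0 < θ₁) (hθ₂ : 0 < θ₂)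
    (hβ : β = θ₁ / (θ₁ + θ₂))
    (R : ℕ → RumorProcess Ω)
    (hR : ∀ n : ℕ, 1 ≤ n → IsLMRModel P n lam th gam δ β (R n))
    (u₀ y₀ z₀ : ℝ) (hu₀ : 0 < u₀) (hy₀ : 0 < y₀) (hz₀ : 0 < z₀) (hsum : u₀ + y₀ + z₀ < 1)
    (hinit : TendstoInMeasure P
      (fun (n : ℕ) ω => (((R n).U 0 ω : ℝ) / n, ((R n).Y 0 ω : ℝ) / n, ((R n).Z 0 ω : ℝ) / n))
      atTop (fun _ => (u₀, y₀, z₀))) :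
    ∃ x u y z : ℝ≥0 → ℝ,
      IsFluidSolution lam th gam δ β u₀ y₀ z₀ x u y z ∧
      (∀ x' u' y' z' : ℝ≥0 → ℝ, IsFluidSolution lam th gam δ β u₀ y₀ z₀ x' u' y' z' →
        x' = x ∧ u' = u ∧ y' = y ∧ z' = z) ∧
      ConvergesInProbabilityD P
        (fun n t ω => ![((R n).X t ω : ℝ) / n, ((R n).U t ω : ℝ) / n,
          ((R n).Y t ω : ℝ) / n, ((R n).Z t ω : ℝ) / n])
        (fun t => ![x t, u t, y t, z t]) := by
  obtain ⟨K₁, hK₁⟩ := hlam_bdd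
  obtain ⟨K₂, hK₂⟩ := hth_bdd
  obtain ⟨K₃, hK₃⟩ := hgam_bdd
  set K : ℝ := max K₁ (max K₂ K₃) with hKdef
  have hlamK : ∀ t, (lam t : ℝ) ≤ K := fun t =>
    (NNReal.coe_le_coe.2 (hK₁ t)).trans (by simp [hKdef])
  have hthK : ∀ t, (th t : ℝ) ≤ K := fun t =>
    (NNReal.coe_le_coe.2 (hK₂ t)).trans (by simp [hKdef])
  have hgamK : ∀ t, (gam t : ℝ) ≤ K := fun t =>
    (NNReal.coe_le_coe.2 (hK₃ t)).trans (by simp [hKdef])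
  have hK : 0 ≤ K := (NNReal.coe_nonneg _).trans (hlamK 0)
  have hβI : β ∈ Icc (0 : ℝ) 1 := by
    rw [hβ]
    exact ⟨by positivity, div_le_one_of_le₀ (by linarith) (by linarith)⟩
  obtain ⟨x, u, y, z, hsol, hmem⟩ := exists_fluidSolution (δ := δ) (β := β) hlam hth hgam hlamK
    hthK hgamK hδ hβI hu₀.le hy₀.le hz₀.le hsum.le
  refine ⟨x, u, y, z, hsol, fun x' u' y' z' h' =>
    h'.unique hlam hth hgam hlamK hthK hgamK hδ hβI hsol, fun T ε hε => ?_⟩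
  set E : ℝ := Real.exp (2 * (18 * (K * 1) + 1) * T) with hE
  have hE0 : 0 < E := Real.exp_pos _
  -- Stability turns the error `9 * η` into `2 * (8 * (9 * η)) * E = 144 * η * E`, which is to equal
  -- `ε`.
  set η : ℝ := ε / (144 * E) with hηdef
  have hη : 0 < η := by positivity
  have limA := tendsto_measure_compensated hK (fun n hn => (hR n hn).intensity_A)
    (fun n hn t ω => ((hR n hn).counts_le t ω).1)
    (fun n hn t ω => ((hR n hn).intensity_le hlamK hthK hgamK t ω).1) T hη
  have limB := tendsto_measure_compensated hK (fun n hn => (hR n hn).intensity_B)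
    (fun n hn t ω => ((hR n hn).counts_le t ω).2.1)
    (fun n hn t ω => ((hR n hn).intensity_le hlamK hthK hgamK t ω).2.1) T hη
  have limC := tendsto_measure_compensated hK (fun n hn => (hR n hn).intensity_C)
    (fun n hn t ω => ((hR n hn).counts_le t ω).2.2)
    (fun n hn t ω => ((hR n hn).intensity_le hlamK hthK hgamK t ω).2.2) T hη
  have limMA := tendsto_measure_markCount (fun n hn => (hR n hn).uniform_markA) hδ hη
  have limMB := tendsto_measure_markCount (fun n hn => (hR n hn).uniform_markB) hβI hη
  have lim0 := tendstoInMeasure_iff_dist.1 hinit η hη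
  -- Outside these six exceptional events the deterministic estimate applies; their probabilities
  -- add up to something tending to `0`.
  have hlim := ((((lim0.add limA).add limB).add limC).add limMA).add limMB
  simp only [add_zero] at hlim
  obtain ⟨n₀, hn₀⟩ := exists_nat_ge (K * T / η)
  refine tendsto_of_tendsto_of_tendsto_of_le_of_le' tendsto_const_nhds hlim
    (Eventually.of_forall fun _ => zero_le) ?_
  filter_upwards [eventually_ge_atTop 1, eventually_ge_atTop n₀] with n hn1 hn
  have hKη : K * T ≤ η * n := by
    rw [div_le_iff₀ hη, mul_comm _ η] at hn₀
    exact hn₀.trans (mul_le_mul_of_nonneg_left (Nat.cast_le.2 hn) hη.le)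
  refine le_trans (measure_mono ?_) ((measure_union_le _ _).trans (add_le_add_left
    ((measure_union_le _ _).trans (add_le_add_left ((measure_union_le _ _).trans (add_le_add_left
    ((measure_union_le _ _).trans (add_le_add_left (measure_union_le _ _) _)) _)) _)) _))
  rintro ω ⟨t, ht, hlt⟩
  by_contra hnot
  simp only [mem_union, not_or] at hnot
  obtain ⟨⟨⟨⟨⟨n0, nA⟩, nB⟩, nC⟩, nMA⟩, nMB⟩ := hnot
  simp only [mem_ofPred_eq, not_exists, not_and, not_lt, not_le] at n0 nA nB nC nMA nMB
  rw [Prod.dist_eq, Prod.dist_eq, max_lt_iff, max_lt_iff, Real.dist_eq, Real.dist_eq,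
    Real.dist_eq] at n0
  have happ := (hR n hn1).isApproxFluid hn1 hth hthK hδ hβI hη.le hKη n0.1.le n0.2.1.le n0.2.2.le
    nA nB nC nMA nMB
  have abs_one : ∀ {r : ℝ}, r ∈ Icc (0 : ℝ) 1 → |r| ≤ 1 := fun hr => by
    rw [abs_of_nonneg hr.1]
    exact hr.2
  have hd := happ.abs_sub_le hlam hth hgam hlamK hthK hgamK hδ hβI
    (hsol.isApproxFluid (by positivity) (fun t _ => abs_one (hmem t).1)
      (fun t _ => abs_one (hmem t).2.1) (fun t _ => abs_one (hmem t).2.2.1)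
      (fun t _ => abs_one (hmem t).2.2.2)) t ht
  have hexp : Real.exp (2 * (18 * (K * 1) + 1) * t) ≤ E := by
    rw [hE]
    have := NNReal.coe_le_coe.2 ht
    gcongr
  have htot : 2 * (8 * (9 * η)) * Real.exp (2 * (18 * (K * 1) + 1) * t) ≤ ε := by
    refine (mul_le_mul_of_nonneg_left hexp (by positivity)).trans (le_of_eq ?_)
    rw [hηdef]
    field_simp
    norm_num
  refine hlt.not_ge ((pi_norm_le_iff_of_nonneg hε.le).2 fun i => ?_)
  have p1 := abs_nonneg ((R n).X t ω / n - x t)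
  have p2 := abs_nonneg ((R n).U t ω / n - u t)
  have p3 := abs_nonneg ((R n).Y t ω / n - y t)
  have p4 := abs_nonneg ((R n).Z t ω / n - z t)
  rw [Real.norm_eq_abs]
  fin_cases i
  · change |((R n).X t ω : ℝ) / n - x t| ≤ ε
    linarith
  · change |((R n).U t ω : ℝ) / n - u t| ≤ ε
    linarith
  · change |((R n).Y t ω : ℝ) / n - y t| ≤ ε
    linarith
  · change |((R n).Z t ω : ℝ) / n - z t| ≤ ε
    linarith
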